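/- Let $(\mathcal M,\otimes,\mathbf 1,c)$ be a braided monoidal category which is abelian, cocomplete and complete and satisfies AB5. Assume that for every object $X$ the functors $X\otimes(-)$ and $(-)\otimes X$ are additive, exact, and commute with direct sums (coproducts). A \emph{braided bialgebra} in $(\mathcal M,c)$ is an object with an algebra and a coalgebra structure whose comultiplication and counit are algebra homomorphisms, the tensor square carrying the multiplication $(m\otimes m)(\mathrm{id}\otimes c\otimes \mathrm{id})$. Let $\pi:E\to B$ be an epimorphism in $\mathcal M$ which is a homomorphism of braided bialgebras, and let $I=\ker\pi$. Put $I^0=E$ and let $I^{n+1}=I^nI$ be the image of $I^n\otimes I\to E\otimes E\xrightarrow{m_E}E$. Assume that the canonical morphism $E/I^{a+1}\to E/I^{a}$ is a split epimorphism in $\mathcal M$ for every $a\in\mathbb N$. Put $gr_IE=\bigoplus_{n\in\mathbb N}I^n/I^{n+1}$. Then the following hold. 1. There is a unique algebra structure on $\bigoplus_n I^n$ whose multiplication has components $I^a\otimes I^b\to I^{a+b}$ induced by $m_E$ and whose unit is induced, in degree $0$, by the unit of $E$. There is a unique coalgebra structure on $\bigoplus_n E/I^{n+1}$ whose comultiplication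 has components $E/I^{a+b+1}\to E/I^{a+1}\otimes E/I^{b+1}$ induced by $\Delta_E$ and whose counit is induced by $\varepsilon_E$ in degree $0$ and is zero in positive degrees. 2. There is a unique algebra structure on $gr_IE$ making the canonical morphism $\bigoplus_n I^n\to gr_IE$ (the direct sum of the projections $I^n\to I^n/I^{n+1}$) an algebra homomorphism, and a unique coalgebra structure on $gr_IE$ making the canonical morphism $gr_IE\to\bigoplus_n E/I^{n+1}$ (the direct sum of the morphisms induced by the inclusions $I^n\to E$) a coalgebra homomorphism. 3. With these two structures $gr_IE$ is a graded braided bialgebra in $(\mathcal M,c)$, with graduation $(I^n/I^{n+1})_{n\in\mathbb N}$. That is, it is a braided bialgebra whose multiplication and comultiplication are graded homomorphisms, where $(gr_IE\otimes gr_IE)_n=\bigoplus_{a+b=n}(I^a/I^{a+1})\otimes(I^b/I^{b+1})$. -/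

import Mathlib

open CategoryTheory CategoryTheory.Limits MonoidalCategory
open scoped MonObj ComonObj

universe v u

noncomputable section

namespace GradedBialgebra

section Graded

variable {C : Type u} [Category.{v} C] [MonoidalCategory C] [HasColimits C]

/-- The graded object `⨁ₙ Xₙ` attached to a sequence of objects. -/
abbrev dirSum (X : ℕ → C) : C := ∐ X

/-- The degree `n` part `⨁_{a+b=n} Xₐ ⊗ X_b` of the tensor square of a graded object. -/
abbrev tensorDeg (X : ℕ → C) (n : ℕ) : C :=
  ∐ fun p : Finset.HasAntidiagonal.antidiagonal n => X p.1.1 ⊗ X p.1.2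

/-- The canonical morphism from the degree `n` part of the tensor square to the tensor square. -/
def tensorDegIncl (X : ℕ → C) (n : ℕ) : tensorDeg X n ⟶ dirSum X ⊗ dirSum X :=
  Limits.Sigma.desc fun p => Limits.Sigma.ι X p.1.1 ⊗ₘ Limits.Sigma.ι X p.1.2

/-- An algebra structure on `⨁ₙ Xₙ` makes it a graded algebra: the multiplication is a graded
homomorphism. -/
def IsGradedAlgebra (X : ℕ → C) (A : MonObj (dirSum X)) : Prop :=
  ∀ n : ℕ, ∃ m : tensorDeg X n ⟶ X n, tensorDegIncl X n ≫ A.mul = m ≫ Limits.Sigma.ι X n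

/-- A coalgebra structure on `⨁ₙ Xₙ` makes it a graded coalgebra: the comultiplication is a graded
homomorphism. -/
def IsGradedCoalgebra (X : ℕ → C) (D : ComonObj (dirSum X)) : Prop :=
  ∀ n : ℕ, ∃ d : X n ⟶ tensorDeg X n, Limits.Sigma.ι X n ≫ D.comul = d ≫ tensorDegIncl X n

/-- A braided bialgebra structure on `⨁ₙ Xₙ` makes it a graded braided bialgebra: it is a graded
algebra and a graded coalgebra for this graduation. -/
def IsGradedBialgebra [BraidedCategory C] (X : ℕ → C) (G : BimonObj (dirSum X)) : Prop :=
  IsGradedAlgebra X G.toMonObj ∧ IsGradedCoalgebra X G.toComonObj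

end Graded

section Powers

variable {C : Type u} [Category.{v} C] [Abelian C] [MonoidalCategory C]
variable {E : C} [MonObj E]

/-- The product `I J` of two subobjects of an algebra: the image of `I ⊗ J ⟶ E ⊗ E ⟶ E`. -/
def prodSub (I J : Subobject E) : Subobject E :=
  imageSubobject ((I.arrow ⊗ₘ J.arrow) ≫ μ[E])

/-- The powers of a subobject of an algebra: `I⁰ = E` and `Iⁿ⁺¹ = Iⁿ I`. -/
def powSub (I : Subobject E) : ℕ → Subobject E
  | 0 => ⊤
  | n + 1 => prodSub (powSub I n) I

theorem prodSub_mono_left {I I' : Subobject E} (h : I ≤ I') (J : Subobject E) :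
    prodSub I J ≤ prodSub I' J := by
  have e : (I.arrow ⊗ₘ J.arrow) ≫ μ[E] =
      (Subobject.ofLE I I' h ▷ (J : C)) ≫ (I'.arrow ⊗ₘ J.arrow) ≫ μ[E] := by
    rw [← tensorHom_id, tensorHom_comp_tensorHom_assoc, Subobject.ofLE_arrow, Category.id_comp]
  unfold prodSub
  simp only [e]
  exact imageSubobject_comp_le _ _

theorem powSub_succ_le (I : Subobject E) (n : ℕ) : powSub I (n + 1) ≤ powSub I n := by
  induction n with
  | zero => exact le_top
  | succ n ih => exact prodSub_mono_left ih I

/-- The inclusion `Iⁿ⁺¹ ⟶ Iⁿ`. -/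
def powIncl (I : Subobject E) (n : ℕ) : (powSub I (n + 1) : C) ⟶ (powSub I n : C) :=
  Subobject.ofLE _ _ (powSub_succ_le I n)

/-- The quotient `E / Iⁿ`. -/
abbrev quot (I : Subobject E) (n : ℕ) : C := cokernel (powSub I n).arrow

/-- The projection `E ⟶ E / Iⁿ`. -/
abbrev quotProj (I : Subobject E) (n : ℕ) : E ⟶ quot I n := cokernel.π (powSub I n).arrow

/-- The morphism `E / Iⁿ⁺¹ ⟶ E / Iⁿ` induced by the identity of `E`. -/
def quotMap (I : Subobject E) (n : ℕ) : quot I (n + 1) ⟶ quot I n :=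
  cokernel.map _ _ (powIncl I n) (𝟙 E) (by simp [powIncl])

/-- The component `Iⁿ / Iⁿ⁺¹` of the associated graded object. -/
abbrev grDeg (I : Subobject E) (n : ℕ) : C := cokernel (powIncl I n)

/-- The projection `Iⁿ ⟶ Iⁿ / Iⁿ⁺¹`. -/
abbrev grProj (I : Subobject E) (n : ℕ) : (powSub I n : C) ⟶ grDeg I n := cokernel.π (powIncl I n)

/-- The morphism `Iⁿ / Iⁿ⁺¹ ⟶ E / Iⁿ⁺¹` induced by the inclusion `Iⁿ ⟶ E`. -/
def grIncl (I : Subobject E) (n : ℕ) : grDeg I n ⟶ quot I (n + 1) :=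
  cokernel.map _ _ (𝟙 _) (powSub I n).arrow (by simp [powIncl])

variable [HasColimits C]

/-- The object `⨁ₙ Iⁿ`. -/
abbrev powSum (I : Subobject E) : C := dirSum fun n => (powSub I n : C)

/-- The canonical injection `Iⁿ ⟶ ⨁ₙ Iⁿ`. -/
def powSumι (I : Subobject E) (n : ℕ) : (powSub I n : C) ⟶ powSum I :=
  Limits.Sigma.ι (fun n => (powSub I n : C)) n

/-- The object `⨁ₙ E / Iⁿ⁺¹`. -/
abbrev quotSum (I : Subobject E) : C := dirSum fun n => quot I (n + 1)

/-- The canonical injection `E / Iⁿ⁺¹ ⟶ ⨁ₙ E / Iⁿ⁺¹`. -/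
def quotSumι (I : Subobject E) (n : ℕ) : quot I (n + 1) ⟶ quotSum I :=
  Limits.Sigma.ι (fun n => quot I (n + 1)) n

/-- The associated graded object `gr_I E = ⨁ₙ Iⁿ / Iⁿ⁺¹`. -/
abbrev gr (I : Subobject E) : C := dirSum (grDeg I)

/-- The morphism `⨁ₙ Iⁿ ⟶ gr_I E`, the direct sum of the projections. -/
def powToGr (I : Subobject E) : powSum I ⟶ gr I := Limits.Sigma.map (grProj I)

/-- The morphism `gr_I E ⟶ ⨁ₙ E / Iⁿ⁺¹`, the direct sum of the inclusions. -/
def grToQuot (I : Subobject E) : gr I ⟶ quotSum I := Limits.Sigma.map (grIncl I)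

/-- `A` is the graded algebra structure on `⨁ₙ Iⁿ` whose components
`Iᵃ ⊗ Iᵇ ⟶ Iᵃ⁺ᵇ` and `𝟙 ⟶ I⁰` are induced by the multiplication and the unit of `E`. -/
structure IsPowAlgebra (I : Subobject E) (A : MonObj (powSum I)) : Prop where
  mul : ∀ a b : ℕ, ∃ m : (powSub I a : C) ⊗ (powSub I b : C) ⟶ (powSub I (a + b) : C),
    m ≫ (powSub I (a + b)).arrow = ((powSub I a).arrow ⊗ₘ (powSub I b).arrow) ≫ μ[E] ∧
    (powSumι I a ⊗ₘ powSumι I b) ≫ A.mul =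
      m ≫ powSumι I (a + b)
  one : ∃ e : 𝟙_ C ⟶ (powSub I 0 : C),
    e ≫ (powSub I 0).arrow = η[E] ∧ A.one = e ≫ powSumι I 0

/-- `D` is the graded coalgebra structure on `⨁ₙ E / Iⁿ⁺¹` whose components
`E / Iᵃ⁺ᵇ⁺¹ ⟶ E / Iᵃ⁺¹ ⊗ E / Iᵇ⁺¹` are induced by the comultiplication of `E`, and whose counit is
induced by that of `E` in degree `0` and vanishes in positive degrees. -/
structure IsQuotCoalgebra [MonoidalPreadditive C] [ComonObj E] (I : Subobject E)
    (D : ComonObj (quotSum I)) : Prop where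
  comul : ∀ n : ℕ, quotProj I (n + 1) ≫ quotSumι I n ≫ D.comul =
    ∑ p ∈ Finset.HasAntidiagonal.antidiagonal n, Δ[E] ≫ (quotProj I (p.1 + 1) ⊗ₘ quotProj I (p.2 + 1)) ≫
      (quotSumι I p.1 ⊗ₘ quotSumι I p.2)
  counit_zero : quotProj I 1 ≫ quotSumι I 0 ≫ D.counit = ε[E]
  counit_succ : ∀ n : ℕ, quotSumι I (n + 1) ≫ D.counit = 0

/-- `M` is an algebra structure on `gr_I E` for which `⨁ₙ Iⁿ ⟶ gr_I E` is an algebra homomorphism,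
where `⨁ₙ Iⁿ` carries the algebra structure `A`. -/
def IsGrAlgebra (I : Subobject E) (A : MonObj (powSum I)) (M : MonObj (gr I)) : Prop :=
  @IsMonHom C _ _ (powSum I) (gr I) A M (powToGr I)

/-- `D` is a coalgebra structure on `gr_I E` for which `gr_I E ⟶ ⨁ₙ E / Iⁿ⁺¹` is a coalgebra
homomorphism, where `⨁ₙ E / Iⁿ⁺¹` carries the coalgebra structure `Q`. -/
def IsGrCoalgebra (I : Subobject E) (Q : ComonObj (quotSum I)) (D : ComonObj (gr I)) : Prop :=
  @IsComonHom C _ _ (gr I) (quotSum I) D Q (grToQuot I)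

end Powers

end GradedBialgebra

end

namespace GradedBialgebra

/-! ### Tensor products of coproducts. -/

section Tensor

variable {C : Type u} [Category.{v} C]

/-! The kernel I of π is a right ideal with ε(I) = 0 and Δ(I) ⊆ I ⊗ E + E ⊗ I, and apart from the
splitting hypothesis only these properties of I are used (`IsRightBiideal`). Induction gives IᵃIᵇ ⊆
Iᵃ⁺ᵇ (`powSub_mul_quotProj_add`) and, since Δ is multiplicative and the braiding natural, Δ(Iⁿ) ⊆
Σ_{a+b=n} Iᵃ ⊗ Iᵇ (`powSub_comul_cokernel`). The first inclusion makes ⨁ Iⁿ an algebra, the second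
makes ⨁ E/Iⁿ⁺¹ a coalgebra.

The multiplication of gr descends along the epimorphism ⨁ Iⁿ ⟶ gr, and the comultiplication
restricts along gr ⟶ ⨁ E/Iⁿ⁺¹. The latter is a monomorphism because the exact sequences 0 ⟶ Iⁿ/Iⁿ⁺¹
⟶ E/Iⁿ⁺¹ ⟶ E/Iⁿ split (`mono_grToQuot`). As tensoring is exact, tensor powers of the two maps remain
epi and mono, so cancelling them yields both the axioms and uniqueness.

Compatibility of the two structures is tested from Iᵃ ⊗ Iᵇ into the tensor square of ⨁ E/Iⁿ⁺¹, where
it becomes Δ(xy) = Δ(x)Δ(y) in E ⊗ E (`gr_mul_comul`). The sum Σ Iᵃ ⊗ Iᵇ is only the image of a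
coproduct in E ⊗ E, so Δ(x) is lifted to the coproduct after passing to an epimorphic cover. -/

theorem preservesColimitsOfShape_discrete_zero {D : Type*} [Category* D] (F : C ⥤ D)
    [∀ J : Type v, PreservesColimitsOfShape (Discrete J) F] (J : Type) :
    PreservesColimitsOfShape (Discrete J) F :=
  -- The index sets, ℕ and its antidiagonals, live in `Type`, while preservation is assumed for
  -- `Type v`; `ULift` bridges the two.
  preservesColimitsOfShape_of_equiv (Discrete.equivalence (Equiv.ulift.{v} (α := J))) F

instance hasCoproductsOfShape_zero [HasColimits C] (J : Type) : HasColimitsOfShape (Discrete J) C :=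
  hasColimitsOfShape_of_equivalence (Discrete.equivalence (Equiv.ulift.{v} (α := J)))

/-- An arbitrary functor is allowed so that composites of tensor functors, needed for threefold
products, are covered. -/
theorem map_coprod_ext [HasColimits C] {D : Type*} [Category* D] (F : C ⥤ D)
    [∀ J : Type v, PreservesColimitsOfShape (Discrete J) F] {J : Type} {X : J → C} {Z : D}
    {f g : F.obj (∐ X) ⟶ Z}
    (h : ∀ i, F.map (Sigma.ι X i) ≫ f = F.map (Sigma.ι X i) ≫ g) : f = g :=
  haveI := preservesColimitsOfShape_discrete_zero F J
  Cofan.IsColimit.hom_ext (isColimitOfHasCoproductOfPreservesColimit F X) _ _ h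

variable [HasColimits C] [MonoidalCategory C]

theorem whiskerLeft_coprod_ext
    [∀ (X : C) (J : Type v), PreservesColimitsOfShape (Discrete J) (tensorLeft X)]
    {J : Type} {W Z : C} {X : J → C} {f g : W ⊗ ∐ X ⟶ Z}
    (h : ∀ i, W ◁ Sigma.ι X i ≫ f = W ◁ Sigma.ι X i ≫ g) : f = g :=
  map_coprod_ext (tensorLeft W) h

theorem whiskerRight_coprod_ext
    [∀ (X : C) (J : Type v), PreservesColimitsOfShape (Discrete J) (tensorRight X)]
    {J : Type} {W Z : C} {X : J → C} {f g : (∐ X) ⊗ W ⟶ Z}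
    (h : ∀ i, Sigma.ι X i ▷ W ≫ f = Sigma.ι X i ▷ W ≫ g) : f = g :=
  map_coprod_ext (tensorRight W) h

variable
  [∀ (X : C) (J : Type v), PreservesColimitsOfShape (Discrete J) (tensorLeft X)]
  [∀ (X : C) (J : Type v), PreservesColimitsOfShape (Discrete J) (tensorRight X)]

/-- Tensoring on the left a coproduct indexed by a small type yields a coproduct. -/
noncomputable def whiskerLeftIsColimit {J : Type} (W : C) (X : J → C) :
    IsColimit (Cofan.mk (W ⊗ ∐ X) fun i => W ◁ Sigma.ι X i) :=
  haveI := preservesColimitsOfShape_discrete_zero (tensorLeft W) J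
  isColimitOfHasCoproductOfPreservesColimit (tensorLeft W) X

/-- Tensoring on the right a coproduct indexed by a small type yields a coproduct. -/
noncomputable def whiskerRightIsColimit {J : Type} (X : J → C) (W : C) :
    IsColimit (Cofan.mk ((∐ X) ⊗ W) fun i => Sigma.ι X i ▷ W) :=
  haveI := preservesColimitsOfShape_discrete_zero (tensorRight W) J
  isColimitOfHasCoproductOfPreservesColimit (tensorRight W) X

theorem tensor_coprod_ext {J K : Type} {Z : C} {X : J → C} {Y : K → C} {f g : (∐ X) ⊗ (∐ Y) ⟶ Z}
    (h : ∀ i j, (Sigma.ι X i ⊗ₘ Sigma.ι Y j) ≫ f = (Sigma.ι X i ⊗ₘ Sigma.ι Y j) ≫ g) : f = g := by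
  refine whiskerRight_coprod_ext fun i => whiskerLeft_coprod_ext fun j => ?_
  simpa [MonoidalCategory.tensorHom_def'] using h i j

theorem tensor_tensor_coprod_ext {J K L : Type} {U : C} {X : J → C} {Y : K → C} {Z : L → C}
    {f g : ((∐ X) ⊗ (∐ Y)) ⊗ (∐ Z) ⟶ U}
    (h : ∀ i j k, ((Sigma.ι X i ⊗ₘ Sigma.ι Y j) ⊗ₘ Sigma.ι Z k) ≫ f =
      ((Sigma.ι X i ⊗ₘ Sigma.ι Y j) ⊗ₘ Sigma.ι Z k) ≫ g) : f = g := by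
  refine whiskerLeft_coprod_ext fun k => ?_
  refine map_coprod_ext (tensorRight (∐ Y) ⋙ tensorRight (Z k)) fun i => ?_
  refine map_coprod_ext (tensorLeft (X i) ⋙ tensorRight (Z k)) fun j => ?_
  have e : ((Sigma.ι X i ⊗ₘ Sigma.ι Y j) ⊗ₘ Sigma.ι Z k) =
      (X i ◁ Sigma.ι Y j) ▷ Z k ≫ (Sigma.ι X i ▷ ∐ Y) ▷ Z k ≫ ((∐ X) ⊗ ∐ Y) ◁ Sigma.ι Z k := by
    rw [MonoidalCategory.tensorHom_def, MonoidalCategory.tensorHom_def', comp_whiskerRight,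
      Category.assoc]
  simpa [e] using h i j k

/-- The morphism out of a tensor product of coproducts with given components. -/
noncomputable def tensorDesc {J K : Type} {Z : C} {X : J → C} {Y : K → C}
    (f : ∀ i j, X i ⊗ Y j ⟶ Z) : (∐ X) ⊗ (∐ Y) ⟶ Z :=
  Cofan.IsColimit.desc (whiskerRightIsColimit X (∐ Y)) fun i =>
    Cofan.IsColimit.desc (whiskerLeftIsColimit (X i) Y) fun j => f i j

@[simp]
theorem ι_tensorDesc {J K : Type} {Z : C} {X : J → C} {Y : K → C}
    (f : ∀ i j, X i ⊗ Y j ⟶ Z) (i : J) (j : K) :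
    (Sigma.ι X i ⊗ₘ Sigma.ι Y j) ≫ tensorDesc f = f i j := by
  have h₁ := Cofan.IsColimit.fac (whiskerRightIsColimit X (∐ Y)) (fun i =>
    Cofan.IsColimit.desc (whiskerLeftIsColimit (X i) Y) fun j => f i j) i
  have h₂ := Cofan.IsColimit.fac (whiskerLeftIsColimit (X i) Y) (fun j => f i j) j
  rw [MonoidalCategory.tensorHom_def', Category.assoc, ← h₂]
  exact congrArg _ h₁

end Tensor

/-! ### Algebras descend along epimorphisms, coalgebras restrict along monomorphisms. -/

section Transport

variable {C : Type u} [Category.{v} C] [MonoidalCategory C]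

section Epi

variable [∀ X : C, PreservesFiniteColimits (tensorLeft X)]
  [∀ X : C, PreservesFiniteColimits (tensorRight X)]

instance epi_whiskerLeft (X : C) {Y Z : C} (f : Y ⟶ Z) [Epi f] : Epi (X ◁ f) :=
  inferInstanceAs (Epi ((tensorLeft X).map f))

instance epi_whiskerRight {Y Z : C} (f : Y ⟶ Z) (X : C) [Epi f] : Epi (f ▷ X) :=
  inferInstanceAs (Epi ((tensorRight X).map f))

instance epi_tensorHom {X Y Z W : C} (f : X ⟶ Y) (g : Z ⟶ W) [Epi f] [Epi g] : Epi (f ⊗ₘ g) := by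
  rw [MonoidalCategory.tensorHom_def]
  infer_instance

/-- An algebra structure descends along an epimorphism compatible with the multiplications. -/
abbrev monObjOfEpi {A X : C} (p : A ⟶ X) [Epi p]
    (mA : MonObj A) (m : X ⊗ X ⟶ X) (hm : (p ⊗ₘ p) ≫ m = mA.mul ≫ p) : MonObj X where
  one := mA.one ≫ p
  mul := m
  one_mul := by
    have h : (mA.one ⊗ₘ 𝟙 A) ≫ mA.mul = (λ_ A).hom := by simp
    rw [← cancel_epi (𝟙_ C ◁ p), ← id_tensorHom, ← tensorHom_id, tensorHom_comp_tensorHom_assoc,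
      Category.id_comp, Category.comp_id, ← Category.id_comp p, ← Category.assoc _ _ p,
      Category.comp_id, ← tensorHom_comp_tensorHom_assoc, Category.id_comp, hm, reassoc_of% h]
    simp
  mul_one := by
    have h : (𝟙 A ⊗ₘ mA.one) ≫ mA.mul = (ρ_ A).hom := by simp
    rw [← cancel_epi (p ▷ 𝟙_ C), ← id_tensorHom, ← tensorHom_id, tensorHom_comp_tensorHom_assoc,
      Category.id_comp, Category.comp_id, ← Category.id_comp p, ← Category.assoc _ _ p,
      Category.comp_id, ← tensorHom_comp_tensorHom_assoc, Category.id_comp, hm, reassoc_of% h]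
    simp
  mul_assoc := by
    have h₁ : ((p ⊗ₘ p) ⊗ₘ p) ≫ m ▷ X ≫ m = mA.mul ▷ A ≫ mA.mul ≫ p := by
      rw [← tensorHom_id m, tensorHom_comp_tensorHom_assoc, hm, Category.comp_id,
        ← whiskerRight_comp_tensorHom_assoc, hm]
    have h₂ : (p ⊗ₘ (p ⊗ₘ p)) ≫ X ◁ m ≫ m = A ◁ mA.mul ≫ mA.mul ≫ p := by
      rw [← id_tensorHom _ m, tensorHom_comp_tensorHom_assoc, hm, Category.comp_id,
        ← whiskerLeft_comp_tensorHom_assoc, hm]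
    -- The triple tensor power of `p` is epi, so associativity is inherited from `A`.
    rw [← cancel_epi ((p ⊗ₘ p) ⊗ₘ p), h₁, associator_naturality_assoc, h₂]
    simp

end Epi

section Mono

variable [∀ X : C, PreservesFiniteLimits (tensorLeft X)]
  [∀ X : C, PreservesFiniteLimits (tensorRight X)]

instance mono_whiskerLeft (X : C) {Y Z : C} (f : Y ⟶ Z) [Mono f] : Mono (X ◁ f) :=
  inferInstanceAs (Mono ((tensorLeft X).map f))

instance mono_whiskerRight {Y Z : C} (f : Y ⟶ Z) (X : C) [Mono f] : Mono (f ▷ X) :=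
  inferInstanceAs (Mono ((tensorRight X).map f))

instance mono_tensorHom {X Y Z W : C} (f : X ⟶ Y) (g : Z ⟶ W) [Mono f] [Mono g] :
    Mono (f ⊗ₘ g) := by
  rw [MonoidalCategory.tensorHom_def]
  infer_instance

/-- A coalgebra structure restricts along a monomorphism compatible with the
comultiplications. -/
abbrev comonObjOfMono {X Q : C} (j : X ⟶ Q) [Mono j]
    (cQ : ComonObj Q) (d : X ⟶ X ⊗ X) (hd : d ≫ (j ⊗ₘ j) = j ≫ cQ.comul) : ComonObj X where
  counit := j ≫ cQ.counit
  comul := d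
  counit_comul := by
    rw [← cancel_mono (𝟙_ C ◁ j), Category.assoc, ← id_tensorHom, ← tensorHom_id,
      tensorHom_comp_tensorHom, Category.id_comp, Category.comp_id, ← Category.comp_id j,
      Category.assoc, Category.id_comp, ← tensorHom_comp_tensorHom, Category.comp_id, reassoc_of% hd]
    simp
  comul_counit := by
    rw [← cancel_mono (j ▷ 𝟙_ C), Category.assoc, ← id_tensorHom, ← tensorHom_id,
      tensorHom_comp_tensorHom, Category.id_comp, Category.comp_id, ← Category.comp_id j,
      Category.assoc, Category.id_comp, ← tensorHom_comp_tensorHom, Category.comp_id, reassoc_of% hd]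
    simp
  comul_assoc := by
    have h₁ : d ≫ d ▷ X ≫ ((j ⊗ₘ j) ⊗ₘ j) = j ≫ cQ.comul ≫ cQ.comul ▷ Q := by
      rw [← reassoc_of% hd, ← tensorHom_id, ← tensorHom_id, tensorHom_comp_tensorHom,
        tensorHom_comp_tensorHom, hd, Category.id_comp, Category.comp_id]
    have h₂ : d ≫ X ◁ d ≫ (j ⊗ₘ j ⊗ₘ j) = j ≫ cQ.comul ≫ Q ◁ cQ.comul := by
      rw [← reassoc_of% hd, ← id_tensorHom, ← id_tensorHom, tensorHom_comp_tensorHom,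
        tensorHom_comp_tensorHom, hd, Category.id_comp, Category.comp_id]
    rw [← cancel_mono (j ⊗ₘ j ⊗ₘ j), Category.assoc, h₂, Category.assoc, Category.assoc,
      ← associator_naturality, reassoc_of% h₁]
    simp

end Mono

end Transport

/-! ### Factoring morphisms through tensor products of quotients or of kernels. -/

section Exact

variable {C : Type u} [Category.{v} C] [Abelian C] [MonoidalCategory C] [MonoidalPreadditive C]

/-- A morphism out of `A ⊗ B` vanishing on the kernels of two epimorphisms `A ⟶ A'` and `B ⟶ B'`
factors through `A' ⊗ B'`. -/
theorem exists_tensor_desc [∀ X : C, PreservesFiniteColimits (tensorLeft X)]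
    [∀ X : C, PreservesFiniteColimits (tensorRight X)] (S T : ShortComplex C) (hS : S.Exact)
    (hT : T.Exact) [Epi S.g] [Epi T.g] {Z : C} (f : S.X₂ ⊗ T.X₂ ⟶ Z) (h₁ : S.f ▷ T.X₂ ≫ f = 0)
    (h₂ : S.X₂ ◁ T.f ≫ f = 0) : ∃ g : S.X₃ ⊗ T.X₃ ⟶ Z, (S.g ⊗ₘ T.g) ≫ g = f := by
  have hS' := hS.map_of_epi_of_preservesCokernel (tensorRight T.X₂) inferInstance inferInstance
  have hT' := hT.map_of_epi_of_preservesCokernel (tensorLeft S.X₃) inferInstance inferInstance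
  have : Epi (S.map (tensorRight T.X₂)).g := epi_whiskerRight S.g T.X₂
  have : Epi (T.map (tensorLeft S.X₃)).g := epi_whiskerLeft S.X₃ T.g
  obtain ⟨k, hk⟩ : ∃ k : S.X₃ ⊗ T.X₂ ⟶ Z, S.g ▷ T.X₂ ≫ k = f :=
    ⟨hS'.desc f h₁, hS'.g_desc f h₁⟩
  -- One variable is treated at a time. The second vanishing condition passes from `S.X₂` to `S.X₃`
  -- because `S.g ▷ T.X₁` is epi.
  have hk₂ : S.X₃ ◁ T.f ≫ k = 0 := by
    rw [← cancel_epi (S.g ▷ T.X₁), ← whisker_exchange_assoc, hk, h₂, comp_zero]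
  obtain ⟨g, hg⟩ : ∃ g : S.X₃ ⊗ T.X₃ ⟶ Z, S.X₃ ◁ T.g ≫ g = k :=
    ⟨hT'.desc k hk₂, hT'.g_desc k hk₂⟩
  exact ⟨g, by rw [MonoidalCategory.tensorHom_def, Category.assoc, hg, hk]⟩

/-- A morphism to `A ⊗ B` killed by two morphisms with kernels `A' ⟶ A` and `B' ⟶ B`
factors through `A' ⊗ B'`. -/
theorem exists_tensor_lift [∀ X : C, PreservesFiniteLimits (tensorLeft X)]
    [∀ X : C, PreservesFiniteLimits (tensorRight X)] (S T : ShortComplex C) (hS : S.Exact)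
    (hT : T.Exact) [Mono S.f] [Mono T.f] {Z : C} (f : Z ⟶ S.X₂ ⊗ T.X₂) (h₁ : f ≫ S.g ▷ T.X₂ = 0)
    (h₂ : f ≫ S.X₂ ◁ T.g = 0) : ∃ g : Z ⟶ S.X₁ ⊗ T.X₁, g ≫ (S.f ⊗ₘ T.f) = f := by
  have hS' := hS.map_of_mono_of_preservesKernel (tensorRight T.X₂) inferInstance inferInstance
  have hT' := hT.map_of_mono_of_preservesKernel (tensorLeft S.X₁) inferInstance inferInstance
  have : Mono (S.map (tensorRight T.X₂)).f := mono_whiskerRight S.f T.X₂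
  have : Mono (T.map (tensorLeft S.X₁)).f := mono_whiskerLeft S.X₁ T.f
  obtain ⟨k, hk⟩ : ∃ k : Z ⟶ S.X₁ ⊗ T.X₂, k ≫ S.f ▷ T.X₂ = f :=
    ⟨hS'.lift f h₁, hS'.lift_f f h₁⟩
  have hk₂ : k ≫ S.X₁ ◁ T.g = 0 := by
    rw [← cancel_mono (S.f ▷ T.X₃), Category.assoc, whisker_exchange, reassoc_of% hk, h₂, zero_comp]
  obtain ⟨g, hg⟩ : ∃ g : Z ⟶ S.X₁ ⊗ T.X₁, g ≫ S.X₁ ◁ T.f = k :=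
    ⟨hT'.lift k hk₂, hT'.lift_f k hk₂⟩
  exact ⟨g, by rw [MonoidalCategory.tensorHom_def', reassoc_of% hg, hk]⟩

end Exact

theorem tensor_mul_assoc {C : Type u} [Category.{v} C] [MonoidalCategory C] {E : C} [MonObj E]
    {X Y Z : C} (f : X ⟶ E) (g : Y ⟶ E) (h : Z ⟶ E) :
    ((f ⊗ₘ g) ≫ μ[E] ⊗ₘ h) ≫ μ[E] = (α_ X Y Z).hom ≫ (f ⊗ₘ (g ⊗ₘ h) ≫ μ[E]) ≫ μ[E] := by
  rw [← tensorHom_comp_whiskerRight, Category.assoc, MonObj.mul_assoc, associator_naturality_assoc,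
    tensorHom_comp_whiskerLeft_assoc]

/-! ### Products of powers of a right ideal. -/

section Powers

variable {C : Type u} [Category.{v} C] [Abelian C] [MonoidalCategory C] {E : C}

theorem powSub_antitone [MonObj E] (I : Subobject E) : Antitone (powSub I) :=
  antitone_nat_of_succ_le (powSub_succ_le I)

theorem powSub_arrow_quotProj [MonObj E] (I : Subobject E) {k n : ℕ} (h : k ≤ n) :
    (powSub I n).arrow ≫ quotProj I k = 0 := by
  rw [← Subobject.ofLE_arrow (powSub_antitone I h), Category.assoc, cokernel.condition, comp_zero]

/-- In an abelian category a monomorphism is the kernel of its cokernel, so containment in Iⁿ can be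
checked as vanishing in E/Iⁿ. -/
theorem exists_lift_powSub [MonObj E] (I : Subobject E) {n : ℕ} {X : C} (f : X ⟶ E)
    (h : f ≫ quotProj I n = 0) : ∃ g : X ⟶ (powSub I n : C), g ≫ (powSub I n).arrow = f :=
  ⟨Abelian.monoLift _ f h, Abelian.monoLift_comp _ f h⟩

instance isIso_powSub_zero_arrow [MonObj E] (I : Subobject E) : IsIso (powSub I 0).arrow :=
  inferInstanceAs (IsIso (⊤ : Subobject E).arrow)

theorem quotProj_zero [MonObj E] (I : Subobject E) : quotProj I 0 = 0 := by
  rw [← cancel_epi (powSub I 0).arrow, cokernel.condition, comp_zero]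

/-- The epimorphism `Iⁿ ⊗ I ⟶ Iⁿ⁺¹` induced by the multiplication. -/
noncomputable def powSubMul [MonObj E] (I : Subobject E) (n : ℕ) :
    (powSub I n : C) ⊗ (I : C) ⟶ (powSub I (n + 1) : C) :=
  factorThruImageSubobject (((powSub I n).arrow ⊗ₘ I.arrow) ≫ μ[E])

instance epi_powSubMul [MonObj E] (I : Subobject E) (n : ℕ) : Epi (powSubMul I n) :=
  inferInstanceAs (Epi (factorThruImageSubobject _))

theorem powSubMul_arrow [MonObj E] (I : Subobject E) (n : ℕ) :
    powSubMul I n ≫ (powSub I (n + 1)).arrow = ((powSub I n).arrow ⊗ₘ I.arrow) ≫ μ[E] :=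
  imageSubobject_arrow_comp _

/-- By definition I¹ is the product E·I rather than I itself; the inclusion comes from x = 1·x. -/
theorem exists_le_powSub_one [MonObj E] (I : Subobject E) :
    ∃ k : (I : C) ⟶ (powSub I 1 : C), k ≫ (powSub I 1).arrow = I.arrow := by
  refine ⟨(λ_ _).inv ≫ (η[E] ≫ inv (powSub I 0).arrow) ▷ _ ≫ powSubMul I 0, ?_⟩
  rw [Category.assoc, Category.assoc, powSubMul_arrow, whiskerRight_comp_tensorHom_assoc,
    Category.assoc, IsIso.inv_hom_id, Category.comp_id, MonoidalCategory.tensorHom_def',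
    Category.assoc, MonObj.one_mul, leftUnitor_naturality, Iso.inv_hom_id_assoc]

/-- Induction on `b` through Iᵃ(IᵇI) = (IᵃIᵇ)I ⊆ Iᵃ⁺ᵇI. The case `b = 0` is IᵃE ⊆ Iᵃ: trivial for `a
= 0`, where E/I⁰ = 0, and otherwise a consequence of IE ⊆ I applied to the last factor. -/
theorem powSub_mul_quotProj_add [MonObj E] [∀ X : C, PreservesFiniteColimits (tensorLeft X)]
    [∀ X : C, PreservesFiniteColimits (tensorRight X)] (I : Subobject E)
    (hI : I.Factors (I.arrow ▷ E ≫ μ[E])) (a b : ℕ) :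
    ((powSub I a).arrow ⊗ₘ (powSub I b).arrow) ≫ μ[E] ≫ quotProj I (a + b) = 0 := by
  induction b with
  | zero =>
    cases a with
    | zero => rw [quotProj_zero, comp_zero, comp_zero]
    | succ a =>
      rw [← cancel_epi (powSubMul I a ▷ _), whiskerRight_comp_tensorHom_assoc, powSubMul_arrow,
        ← Category.assoc, tensor_mul_assoc, MonoidalCategory.tensorHom_def' I.arrow,
        Category.assoc (_ ◁ _), ← I.factorThru_arrow _ hI, ← Category.assoc (_ ◁ _),
        ← whiskerLeft_comp_tensorHom, Category.assoc, Category.assoc, Category.assoc,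
        ← reassoc_of% powSubMul_arrow, cokernel.condition]
      simp
  | succ b ih =>
    obtain ⟨g, hg⟩ := exists_lift_powSub I (((powSub I a).arrow ⊗ₘ (powSub I b).arrow) ≫ μ[E])
      (by rw [Category.assoc, ih])
    rw [← cancel_epi (_ ◁ powSubMul I b), whiskerLeft_comp_tensorHom_assoc, powSubMul_arrow,
      ← cancel_epi (α_ _ _ _).hom, ← reassoc_of% tensor_mul_assoc, ← hg, ← whiskerRight_comp_tensorHom,
      Category.assoc, ← reassoc_of% powSubMul_arrow, ← add_assoc, cokernel.condition]
    simp

end Powers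

/-! ### The exact sequences of the filtration, and the comultiplication on powers. -/

section Powers

variable {C : Type u} [Category.{v} C] [Abelian C] [MonoidalCategory C] {E : C}

theorem exists_powSub_mul [MonObj E] [∀ X : C, PreservesFiniteColimits (tensorLeft X)]
    [∀ X : C, PreservesFiniteColimits (tensorRight X)] (I : Subobject E)
    (hI : I.Factors (I.arrow ▷ E ≫ μ[E])) (a b : ℕ) :
    ∃ m : (powSub I a : C) ⊗ (powSub I b : C) ⟶ (powSub I (a + b) : C),
      m ≫ (powSub I (a + b)).arrow = ((powSub I a).arrow ⊗ₘ (powSub I b).arrow) ≫ μ[E] :=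
  exists_lift_powSub I _ (by rw [Category.assoc, powSub_mul_quotProj_add I hI])

theorem powSub_mul_quotProj [MonObj E] [∀ X : C, PreservesFiniteColimits (tensorLeft X)]
    [∀ X : C, PreservesFiniteColimits (tensorRight X)] (I : Subobject E)
    (hI : I.Factors (I.arrow ▷ E ≫ μ[E])) {a b n : ℕ} (h : n ≤ a + b) :
    ((powSub I a).arrow ⊗ₘ (powSub I b).arrow) ≫ μ[E] ≫ quotProj I n = 0 := by
  obtain ⟨m, hm⟩ := exists_powSub_mul I hI a b
  rw [← Category.assoc, ← hm, Category.assoc, powSub_arrow_quotProj I h, comp_zero]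

theorem grProj_grIncl [MonObj E] (I : Subobject E) (n : ℕ) :
    grProj I n ≫ grIncl I n = (powSub I n).arrow ≫ quotProj I (n + 1) := by
  simp [grIncl]

theorem quotProj_quotMap [MonObj E] (I : Subobject E) (n : ℕ) :
    quotProj I (n + 1) ≫ quotMap I n = quotProj I n := by
  simp [quotMap]

/-- A generalized element of Iⁿ that dies in E/Iⁿ⁺¹ lies in Iⁿ⁺¹. Elements of the quotient are
lifted to Iⁿ after an epimorphic refinement. -/
instance mono_grIncl [MonObj E] (I : Subobject E) (n : ℕ) : Mono (grIncl I n) := by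
  refine Preadditive.mono_of_cancel_zero _ fun {A} f hf => ?_
  obtain ⟨A', e, _, g, hg⟩ := surjective_up_to_refinements_of_epi (grProj I n) f
  have h : (g ≫ (powSub I n).arrow) ≫ quotProj I (n + 1) = 0 := by
    rw [Category.assoc, ← grProj_grIncl, ← Category.assoc, ← hg, Category.assoc, hf, comp_zero]
  obtain ⟨k, hk⟩ := exists_lift_powSub I _ h
  have hg' : g = k ≫ powIncl I n := by
    rw [← cancel_mono (powSub I n).arrow, ← hk, Category.assoc, powIncl, Subobject.ofLE_arrow]
  rw [← cancel_epi e, hg, hg', Category.assoc, cokernel.condition, comp_zero, comp_zero]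

theorem powIncl_arrow [MonObj E] (I : Subobject E) (n : ℕ) :
    powIncl I n ≫ (powSub I n).arrow = (powSub I (n + 1)).arrow :=
  Subobject.ofLE_arrow _

/-- The sequence `0 ⟶ Iⁿ / Iⁿ⁺¹ ⟶ E / Iⁿ⁺¹ ⟶ E / Iⁿ`. -/
noncomputable abbrev grSequence [MonObj E] (I : Subobject E) (n : ℕ) : ShortComplex C :=
  ShortComplex.mk (grIncl I n) (quotMap I n) (by
    rw [← cancel_epi (grProj I n), reassoc_of% grProj_grIncl, quotProj_quotMap, cokernel.condition,
      comp_zero])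

theorem grSequence_exact [MonObj E] (I : Subobject E) (n : ℕ) : (grSequence I n).Exact := by
  rw [ShortComplex.exact_iff_exact_up_to_refinements]
  intro A f hf
  obtain ⟨A', e, he, g, hg⟩ := surjective_up_to_refinements_of_epi (quotProj I (n + 1)) f
  have h : g ≫ quotProj I n = 0 := by
    rw [← quotProj_quotMap, ← Category.assoc, ← hg, Category.assoc, hf, comp_zero]
  obtain ⟨k, hk⟩ := exists_lift_powSub I _ h
  refine ⟨A', e, he, k ≫ grProj I n, ?_⟩
  rw [Category.assoc, grProj_grIncl, reassoc_of% hk, hg]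

theorem isSplitMono_grIncl [MonObj E] (I : Subobject E) (n : ℕ) [h : IsSplitEpi (quotMap I n)] :
    IsSplitMono (grIncl I n) :=
  let s := ShortComplex.Splitting.ofExactOfSection (grSequence I n) (grSequence_exact I n)
    (section_ (quotMap I n)) (IsSplitEpi.id _) inferInstance
  IsSplitMono.mk' ⟨s.r, s.f_r⟩

/-- The morphism `⨁_{a+b=n} Iᵃ ⊗ Iᵇ ⟶ E ⊗ E` induced by the inclusions. -/
noncomputable def powTensor [HasColimits C] [MonObj E] (I : Subobject E) (n : ℕ) :
    tensorDeg (fun n => (powSub I n : C)) n ⟶ E ⊗ E :=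
  Sigma.desc fun p => (powSub I p.1.1).arrow ⊗ₘ (powSub I p.1.2).arrow

@[simp]
theorem ι_powTensor [HasColimits C] [MonObj E] (I : Subobject E) (n : ℕ)
    (p : Finset.HasAntidiagonal.antidiagonal n) :
    Sigma.ι (fun p : Finset.HasAntidiagonal.antidiagonal n =>
      (powSub I p.1.1 : C) ⊗ (powSub I p.1.2 : C)) p ≫ powTensor I n =
      (powSub I p.1.1).arrow ⊗ₘ (powSub I p.1.2).arrow :=
  Sigma.ι_desc _ _

theorem powSub_tensor_cokernel [HasColimits C] [MonObj E] (I : Subobject E) {a b n : ℕ}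
    (h : a + b = n) :
    ((powSub I a).arrow ⊗ₘ (powSub I b).arrow) ≫ cokernel.π (powTensor I n) = 0 := by
  have := ι_powTensor I n ⟨(a, b), Finset.HasAntidiagonal.mem_antidiagonal.2 h⟩
  rw [← this, Category.assoc, cokernel.condition, comp_zero]

/-- A subobject of a bialgebra which is a right ideal, lies in the kernel of the counit, and whose
comultiplication takes values in `E ⊗ I + I ⊗ E`. -/
structure IsRightBiideal [HasColimits C] [MonObj E] [ComonObj E] (I : Subobject E) : Prop where
  mul : I.Factors (I.arrow ▷ E ≫ μ[E])
  comul : I.arrow ≫ Δ[E] ≫ cokernel.π (powTensor I 1) = 0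
  counit : I.arrow ≫ ε[E] = 0

/-- For the comultiplication: the projection modulo I¹ ⊗ I⁰ + I⁰ ⊗ I¹ kills I ⊗ E and E ⊗ I, hence
factors through π ⊗ π by right exactness, while (π ⊗ π)Δ = Δπ vanishes on I. -/
theorem kernelSubobject_isRightBiideal [HasColimits C] [BraidedCategory C] [MonoidalPreadditive C]
    [∀ X : C, PreservesFiniteColimits (tensorLeft X)]
    [∀ X : C, PreservesFiniteColimits (tensorRight X)]
    {B : C} [BimonObj E] [BimonObj B] (π : E ⟶ B) [Epi π] [IsBimonHom π] :
    IsRightBiideal (kernelSubobject π) where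
  mul := kernelSubobject_factors _ _ (by
    rw [Category.assoc, IsMonHom.mul_hom, whiskerRight_comp_tensorHom_assoc,
      kernelSubobject_arrow_comp, MonoidalPreadditive.zero_tensor, zero_comp])
  comul := by
    set I := kernelSubobject π
    obtain ⟨k, hk⟩ := exists_le_powSub_one I
    let S : ShortComplex C := ShortComplex.mk I.arrow π (kernelSubobject_arrow_comp π)
    have hS : S.Exact := by
      rw [ShortComplex.exact_iff_exact_up_to_refinements]
      intro A f hf
      exact ⟨A, 𝟙 A, inferInstance, factorThruKernelSubobject π f hf, by simp [S, I]⟩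
    have : Epi S.g := inferInstanceAs (Epi π)
    obtain ⟨g, hg⟩ := exists_tensor_desc S S hS hS (cokernel.π (powTensor I 1))
      (by
        -- I⁰ is identified with E by inverting its arrow, and I ⊆ I¹ turns the statement for I¹ ⊗
        -- I⁰ into one for I ⊗ E.
        have := powSub_tensor_cokernel I (show 1 + 0 = 1 from rfl)
        rw [MonoidalCategory.tensorHom_def', Category.assoc,
          ← cancel_epi ((powSub I 1 : C) ◁ inv (powSub I 0).arrow)] at this
        rw [← whiskerLeft_comp_assoc, IsIso.inv_hom_id, whiskerLeft_id, Category.id_comp, comp_zero]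
          at this
        change I.arrow ▷ E ≫ _ = 0
        rw [← hk, comp_whiskerRight, Category.assoc, this, comp_zero])
      (by
        have := powSub_tensor_cokernel I (show 0 + 1 = 1 from rfl)
        rw [MonoidalCategory.tensorHom_def, Category.assoc,
          ← cancel_epi (inv (powSub I 0).arrow ▷ (powSub I 1 : C))] at this
        rw [← comp_whiskerRight_assoc, IsIso.inv_hom_id, id_whiskerRight, Category.id_comp,
          comp_zero] at this
        change E ◁ I.arrow ≫ _ = 0
        rw [← hk, MonoidalCategory.whiskerLeft_comp, Category.assoc, this, comp_zero])
    have h : Δ[E] ≫ (S.g ⊗ₘ S.g) = π ≫ Δ[B] := (IsComonHom.hom_comul π).symm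
    rw [← hg, reassoc_of% h, kernelSubobject_arrow_comp_assoc, zero_comp]
  counit := by
    rw [← IsComonHom.hom_counit π, kernelSubobject_arrow_comp_assoc, zero_comp]

theorem powSub_one_counit [MonoidalPreadditive C] [HasColimits C] [BraidedCategory C] [BimonObj E] {I : Subobject E}
    (hI : IsRightBiideal I) : (powSub I 1).arrow ≫ ε[E] = 0 := by
  rw [← cancel_epi (powSubMul I 0), reassoc_of% powSubMul_arrow, BimonObj.mul_counit, Comon.tensorObj_counit,
    tensorHom_comp_tensorHom_assoc, hI.counit]
  simp

/-- Vanishing in the cokernel means landing in the image of `powTensor I n`. A lift to the coproduct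
itself exists in general only after an epimorphism. -/
theorem exists_cover [HasColimits C] [MonObj E] {I : Subobject E} {X : C} {n : ℕ} (f : X ⟶ E ⊗ E)
    (h : f ≫ cokernel.π (powTensor I n) = 0) :
    ∃ (P : C) (e : P ⟶ X) (_ : Epi e) (t : P ⟶ tensorDeg (fun n => (powSub I n : C)) n),
      e ≫ f = t ≫ powTensor I n :=
  (ShortComplex.exact_cokernel (powTensor I n)).exact_up_to_refinements f h

variable [HasColimits C]
  [∀ X : C, PreservesFiniteColimits (tensorLeft X)]
  [∀ X : C, PreservesFiniteColimits (tensorRight X)]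
  [∀ (X : C) (J : Type v), PreservesColimitsOfShape (Discrete J) (tensorLeft X)]
  [∀ (X : C) (J : Type v), PreservesColimitsOfShape (Discrete J) (tensorRight X)]

/-- Induction through Δ(IⁿI) = Δ(Iⁿ)Δ(I), with Δ(Iⁿ) and Δ(I) lifted to coproducts on covers.
Naturality of the braiding gives (Iⁱ ⊗ Iʲ)(Iᵏ ⊗ Iˡ) ⊆ Iⁱ⁺ᵏ ⊗ Iʲ⁺ˡ, which is `h`. In degree 0 the
cokernel projection is zero, as I⁰ ⊗ I⁰ is all of E ⊗ E. -/
theorem powSub_comul_cokernel [BraidedCategory C] [BimonObj E] {I : Subobject E}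
    (hI : IsRightBiideal I) (n : ℕ) :
    (powSub I n).arrow ≫ Δ[E] ≫ cokernel.π (powTensor I n) = 0 := by
  induction n with
  | zero =>
    have := powSub_tensor_cokernel I (show 0 + 0 = 0 from rfl)
    rw [← comp_zero, cancel_epi] at this
    rw [this, comp_zero, comp_zero]
  | succ n ih =>
    obtain ⟨P, e, _, t, ht⟩ := exists_cover ((powSub I n).arrow ≫ Δ[E])
      (by rw [Category.assoc, ih])
    obtain ⟨P', e', _, t', ht'⟩ := exists_cover (I.arrow ≫ Δ[E])
      (by rw [Category.assoc, hI.comul])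
    have h : (powTensor I n ⊗ₘ powTensor I 1) ≫ tensorμ E E E E ≫ (μ[E] ⊗ₘ μ[E]) ≫
        cokernel.π (powTensor I (n + 1)) = 0 := by
      refine tensor_coprod_ext fun p q => ?_
      obtain ⟨m, hm⟩ := exists_powSub_mul I hI.mul p.1.1 q.1.1
      obtain ⟨m', hm'⟩ := exists_powSub_mul I hI.mul p.1.2 q.1.2
      have hp := Finset.HasAntidiagonal.mem_antidiagonal.1 p.2
      have hq := Finset.HasAntidiagonal.mem_antidiagonal.1 q.2
      rw [tensorHom_comp_tensorHom_assoc, ι_powTensor, ι_powTensor, tensorμ_natural_assoc,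
        tensorHom_comp_tensorHom_assoc, ← hm, ← hm', ← tensorHom_comp_tensorHom_assoc,
        powSub_tensor_cokernel I (by omega)]
      simp
    rw [← cancel_epi (powSubMul I n), reassoc_of% powSubMul_arrow, BimonObj.mul_comul_assoc,
      tensorHom_comp_tensorHom_assoc, ← cancel_epi (e ⊗ₘ e'), tensorHom_comp_tensorHom_assoc, ht,
      ht', ← tensorHom_comp_tensorHom_assoc, h]
    simp

/-- If i + j = n and a + b ≤ n + 1, then i ≥ a or j ≥ b, so every summand Iⁱ ⊗ Iʲ dies in E/Iᵃ ⊗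
E/Iᵇ. -/
theorem powSub_comul_quotProj [MonoidalPreadditive C] [BraidedCategory C] [BimonObj E] {I : Subobject E}
    (hI : IsRightBiideal I) {a b n : ℕ} (h : a + b ≤ n + 1) :
    (powSub I n).arrow ≫ Δ[E] ≫ (quotProj I a ⊗ₘ quotProj I b) = 0 := by
  have hτ : powTensor I n ≫ (quotProj I a ⊗ₘ quotProj I b) = 0 := by
    refine Sigma.hom_ext _ _ fun p => ?_
    have hp := Finset.HasAntidiagonal.mem_antidiagonal.1 p.2
    rw [reassoc_of% ι_powTensor, tensorHom_comp_tensorHom, comp_zero]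
    rcases le_or_gt a p.1.1 with ha | ha
    · rw [powSub_arrow_quotProj I ha, MonoidalPreadditive.zero_tensor]
    · rw [powSub_arrow_quotProj I (show b ≤ p.1.2 by omega), MonoidalPreadditive.tensor_zero]
  rw [← cokernel.π_desc _ _ hτ, reassoc_of% powSub_comul_cokernel hI n, zero_comp]

end Powers

/-! ### Extensionality of algebra and coalgebra structures. -/

section Ext

variable {C : Type u} [Category.{v} C] [MonoidalCategory C]

theorem monObj_ext {X : C} {A A' : MonObj X} (h₁ : A.one = A'.one) (h : A.mul = A'.mul) :
    A = A' := by
  cases A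
  cases A'
  subst h₁ h
  rfl

theorem comonObj_ext {X : C} {D D' : ComonObj X} (h₁ : D.counit = D'.counit)
    (h : D.comul = D'.comul) : D = D' := by
  cases D
  cases D'
  subst h₁ h
  rfl

end Ext

/-! ### The algebra ⨁ Iⁿ. -/

section PowAlgebra

variable {C : Type u} [Category.{v} C] [Abelian C] [MonoidalCategory C] [HasColimits C]
  {E : C} [MonObj E]

/-- Reduces the axioms to identities in E, absorbing degrees such as `0 + b` and `b` that are equal
but not by definition. -/
theorem comp_powSumι_eq (I : Subobject E) {X : C} {n k : ℕ} (h : n = k)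
    (f : X ⟶ (powSub I n : C)) (g : X ⟶ (powSub I k : C))
    (hfg : f ≫ (powSub I n).arrow = g ≫ (powSub I k).arrow) :
    f ≫ powSumι I n = g ≫ powSumι I k := by
  subst h
  rw [(cancel_mono _).1 hfg]

variable
  [∀ (X : C) (J : Type v), PreservesColimitsOfShape (Discrete J) (tensorLeft X)]
  [∀ (X : C) (J : Type v), PreservesColimitsOfShape (Discrete J) (tensorRight X)]

theorem isPowAlgebra_unique (I : Subobject E) {A A' : MonObj (powSum I)} (h : IsPowAlgebra I A)
    (h' : IsPowAlgebra I A') : A = A' := by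
  obtain ⟨e, he, h₁⟩ := h.one
  obtain ⟨e', he', h₁'⟩ := h'.one
  refine monObj_ext ?_ ?_
  · rw [h₁, h₁', (cancel_mono (powSub I 0).arrow).1 (he.trans he'.symm)]
  · refine tensor_coprod_ext fun a b => ?_
    obtain ⟨m, hm, hM⟩ := h.mul a b
    obtain ⟨m', hm', hM'⟩ := h'.mul a b
    exact hM.trans (((cancel_mono (powSub I (a + b)).arrow).1 (hm.trans hm'.symm)) ▸ hM'.symm)

theorem exists_isPowAlgebra [∀ X : C, PreservesFiniteColimits (tensorLeft X)]
    [∀ X : C, PreservesFiniteColimits (tensorRight X)] (I : Subobject E) (hI : I.Factors (I.arrow ▷ E ≫ μ[E])) :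
    ∃ A : MonObj (powSum I), IsPowAlgebra I A := by
  choose m hm using exists_powSub_mul I hI
  let e : 𝟙_ C ⟶ (powSub I 0 : C) := η[E] ≫ inv (powSub I 0).arrow
  have he : e ≫ (powSub I 0).arrow = η[E] := by simp [e]
  let M : powSum I ⊗ powSum I ⟶ powSum I := tensorDesc fun a b => m a b ≫ powSumι I (a + b)
  have hM : ∀ a b, (powSumι I a ⊗ₘ powSumι I b) ≫ M = m a b ≫ powSumι I (a + b) :=
    fun a b => ι_tensorDesc _ a b
  refine ⟨{ one := e ≫ powSumι I 0, mul := M, one_mul := ?_, mul_one := ?_, mul_assoc := ?_ },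
    ⟨fun a b => ⟨m a b, hm a b, hM a b⟩, e, he, rfl⟩⟩
  · refine whiskerLeft_coprod_ext fun b => ?_
    change _ ◁ powSumι I b ≫ _ = _ ◁ powSumι I b ≫ _
    rw [whisker_exchange_assoc, comp_whiskerRight_assoc, ← MonoidalCategory.tensorHom_def_assoc, hM,
      leftUnitor_naturality, ← Category.assoc]
    refine comp_powSumι_eq I (zero_add b) _ _ ?_
    rw [Category.assoc, hm, whiskerRight_comp_tensorHom_assoc, he, MonoidalCategory.tensorHom_def',
      Category.assoc, MonObj.one_mul, leftUnitor_naturality]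
  · refine whiskerRight_coprod_ext fun a => ?_
    change powSumι I a ▷ _ ≫ _ = powSumι I a ▷ _ ≫ _
    rw [← whisker_exchange_assoc, MonoidalCategory.whiskerLeft_comp_assoc,
      ← MonoidalCategory.tensorHom_def'_assoc, hM, rightUnitor_naturality, ← Category.assoc]
    refine comp_powSumι_eq I (add_zero a) _ _ ?_
    rw [Category.assoc, hm, whiskerLeft_comp_tensorHom_assoc, he, MonoidalCategory.tensorHom_def,
      Category.assoc, MonObj.mul_one, rightUnitor_naturality]
  · refine tensor_tensor_coprod_ext fun a b c => ?_
    change ((powSumι I a ⊗ₘ powSumι I b) ⊗ₘ powSumι I c) ≫ _ =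
      ((powSumι I a ⊗ₘ powSumι I b) ⊗ₘ powSumι I c) ≫ _
    rw [tensorHom_comp_whiskerRight_assoc, hM, ← whiskerRight_comp_tensorHom_assoc, hM,
      associator_naturality_assoc, tensorHom_comp_whiskerLeft_assoc, hM,
      ← whiskerLeft_comp_tensorHom_assoc, hM, ← Category.assoc, ← Category.assoc, ← Category.assoc]
    refine comp_powSumι_eq I (add_assoc a b c) _ _ ?_
    rw [Category.assoc, hm, whiskerRight_comp_tensorHom_assoc, hm, Category.assoc, Category.assoc,
      hm, whiskerLeft_comp_tensorHom_assoc, hm, tensor_mul_assoc]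

end PowAlgebra

/-! ### The coalgebra ⨁ E/Iⁿ⁺¹. -/

section QuotCoalgebra

variable {C : Type u} [Category.{v} C] [Abelian C] [MonoidalCategory C] [HasColimits C] {E : C}

/-- The morphism `E ⟶ ⨁ₙ E / Iⁿ⁺¹` of degree `n`. -/
noncomputable def toQuotSum [MonObj E] (I : Subobject E) (n : ℕ) : E ⟶ quotSum I :=
  quotProj I (n + 1) ≫ quotSumι I n

theorem quotSum_ext [MonObj E] {I : Subobject E} {Z : C} {f g : quotSum I ⟶ Z}
    (h : ∀ n, toQuotSum I n ≫ f = toQuotSum I n ≫ g) : f = g := by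
  refine Sigma.hom_ext _ _ fun n => ?_
  rw [← cancel_epi (quotProj I (n + 1))]
  simpa [toQuotSum, quotSumι] using h n

variable [MonoidalPreadditive C]

/-- The degree `n` part of the comultiplication of `E` modulo the powers of `I`. -/
noncomputable def toQuotSumTensor [MonObj E] [ComonObj E] (I : Subobject E) (n : ℕ) :
    E ⟶ quotSum I ⊗ quotSum I :=
  ∑ p ∈ Finset.HasAntidiagonal.antidiagonal n, Δ[E] ≫ (toQuotSum I p.1 ⊗ₘ toQuotSum I p.2)

/-- The projections from E are epi, so the conditions can be stated for maps out of E, where the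
coalgebra axioms of E apply directly. -/
theorem isQuotCoalgebra_iff [MonObj E] [ComonObj E] (I : Subobject E) (D : ComonObj (quotSum I)) :
    IsQuotCoalgebra I D ↔ (∀ n, toQuotSum I n ≫ D.comul = toQuotSumTensor I n) ∧
      toQuotSum I 0 ≫ D.counit = ε[E] ∧ ∀ n, toQuotSum I (n + 1) ≫ D.counit = 0 := by
  have h (n : ℕ) : toQuotSum I n ≫ D.comul = toQuotSumTensor I n ↔
      quotProj I (n + 1) ≫ quotSumι I n ≫ D.comul =
      ∑ p ∈ Finset.HasAntidiagonal.antidiagonal n,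
        Δ[E] ≫ (quotProj I (p.1 + 1) ⊗ₘ quotProj I (p.2 + 1)) ≫
          (quotSumι I p.1 ⊗ₘ quotSumι I p.2) := by
    simp only [toQuotSumTensor, toQuotSum, tensorHom_comp_tensorHom, Category.assoc]
  have h' (n : ℕ) : toQuotSum I (n + 1) ≫ D.counit = 0 ↔ quotSumι I (n + 1) ≫ D.counit = 0 := by
    rw [toQuotSum, Category.assoc, ← comp_zero, cancel_epi]
  constructor
  · intro hD
    exact ⟨fun n => (h n).2 (hD.comul n), by rw [toQuotSum, Category.assoc, hD.counit_zero],
      fun n => (h' n).2 (hD.counit_succ n)⟩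
  · rintro ⟨h₁, h₂, h₃⟩
    exact ⟨fun n => (h n).1 (h₁ n), by rw [← h₂, toQuotSum, Category.assoc],
      fun n => (h' n).1 (h₃ n)⟩

theorem isQuotCoalgebra_unique [MonObj E] [ComonObj E] (I : Subobject E)
    {D D' : ComonObj (quotSum I)} (h : IsQuotCoalgebra I D) (h' : IsQuotCoalgebra I D') :
    D = D' := by
  rw [isQuotCoalgebra_iff] at h h'
  refine comonObj_ext (quotSum_ext fun n => ?_) (quotSum_ext fun n => ?_)
  · cases n with
    | zero => rw [h.2.1, h'.2.1]
    | succ n => rw [h.2.2, h'.2.2]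
  · rw [h.1, h'.1]

theorem exists_isQuotCoalgebra [MonObj E] [ComonObj E] (I : Subobject E)
    (h : ∀ a b n, a + b ≤ n + 1 →
      (powSub I n).arrow ≫ Δ[E] ≫ (quotProj I a ⊗ₘ quotProj I b) = 0)
    (hε : (powSub I 1).arrow ≫ ε[E] = 0) : ∃ D : ComonObj (quotSum I), IsQuotCoalgebra I D := by
  have h₀ (n : ℕ) : (powSub I (n + 1)).arrow ≫ toQuotSumTensor I n = 0 := by
    rw [toQuotSumTensor, Preadditive.comp_sum]
    refine Finset.sum_eq_zero fun p hp => ?_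
    have hp' := Finset.HasAntidiagonal.mem_antidiagonal.1 hp
    rw [toQuotSum, toQuotSum, ← tensorHom_comp_tensorHom,
      -- Here (p.1 + 1) + (p.2 + 1) = (n + 1) + 1, so the bound is attained.
      reassoc_of% h (p.1 + 1) (p.2 + 1) (n + 1) (by omega), zero_comp]
  let d : quotSum I ⟶ quotSum I ⊗ quotSum I := Sigma.desc fun n => cokernel.desc _ _ (h₀ n)
  let c : quotSum I ⟶ 𝟙_ C := Sigma.desc fun
    | 0 => cokernel.desc _ _ hε
    | _ + 1 => 0
  have hd (n : ℕ) : toQuotSum I n ≫ d = toQuotSumTensor I n := by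
    simp [toQuotSum, d, quotSumι]
  have hc₀ : toQuotSum I 0 ≫ c = ε[E] := by
    simp [toQuotSum, c, quotSumι]
  have hc (n : ℕ) : toQuotSum I (n + 1) ≫ c = 0 := by
    simp [toQuotSum, c, quotSumι]
  have hcn (n : ℕ) (hn : n ≠ 0) : toQuotSum I n ≫ c = 0 := by
    obtain ⟨k, rfl⟩ := Nat.exists_eq_succ_of_ne_zero hn
    exact hc k
  let D : ComonObj (quotSum I) :=
    { comul := d
      counit := c
      counit_comul := by
        refine quotSum_ext fun n => ?_
        rw [reassoc_of% hd, toQuotSumTensor, Preadditive.sum_comp,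
          -- The counit vanishes in positive degrees, so a single term survives.
          Finset.sum_eq_single ((0 : ℕ), n)]
        · rw [Category.assoc, tensorHom_comp_whiskerRight, hc₀, MonoidalCategory.tensorHom_def,
            ComonObj.counit_comul_assoc, leftUnitor_inv_naturality]
        · rintro ⟨a, b⟩ hp hne
          have hp' := Finset.HasAntidiagonal.mem_antidiagonal.1 hp
          rw [Category.assoc, tensorHom_comp_whiskerRight, hcn a, MonoidalPreadditive.zero_tensor,
            comp_zero]
          rintro rfl
          exact hne (by simpa using hp')
        · simp
      comul_counit := by
        refine quotSum_ext fun n => ?_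
        rw [reassoc_of% hd, toQuotSumTensor, Preadditive.sum_comp,
          Finset.sum_eq_single (n, (0 : ℕ))]
        · rw [Category.assoc, tensorHom_comp_whiskerLeft, hc₀, MonoidalCategory.tensorHom_def',
            ComonObj.comul_counit_assoc, rightUnitor_inv_naturality]
        · rintro ⟨a, b⟩ hp hne
          have hp' := Finset.HasAntidiagonal.mem_antidiagonal.1 hp
          rw [Category.assoc, tensorHom_comp_whiskerLeft, hcn b, MonoidalPreadditive.tensor_zero,
            comp_zero]
          rintro rfl
          exact hne (by simpa using hp')
        · simp
      comul_assoc := by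
        refine quotSum_ext fun n => ?_
        rw [reassoc_of% hd, reassoc_of% hd, toQuotSumTensor, Preadditive.sum_comp,
          Preadditive.sum_comp]
        simp only [Category.assoc, tensorHom_comp_whiskerLeft, tensorHom_comp_whiskerRight_assoc,
          hd, toQuotSumTensor, tensor_sum, sum_tensor, Preadditive.comp_sum, Preadditive.sum_comp]
        rw [Finset.sum_sigma', Finset.sum_sigma']
        -- Both sums run over triples i + j + k = n, grouped as i + (j + k) and as (i + j) + k.
        refine Finset.sum_nbij' (fun x => ⟨(x.1.1 + x.2.1, x.2.2), (x.1.1, x.2.1)⟩)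
          (fun x => ⟨(x.2.1, x.2.2 + x.1.2), (x.2.2, x.1.2)⟩) ?_ ?_ ?_ ?_ ?_
        all_goals rintro ⟨⟨a, b⟩, ⟨a', b'⟩⟩ h
        all_goals
          simp only [Finset.mem_sigma, Finset.HasAntidiagonal.mem_antidiagonal] at h ⊢
        · exact ⟨by lia, trivial⟩
        · exact ⟨by lia, trivial⟩
        · obtain ⟨-, rfl⟩ := h
          rfl
        · obtain ⟨-, rfl⟩ := h
          rfl
        · rw [← whiskerLeft_comp_tensorHom, ← whiskerRight_comp_tensorHom, Category.assoc,
            associator_naturality, ComonObj.comul_assoc_assoc] }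
  exact ⟨D, (isQuotCoalgebra_iff I D).2 ⟨hd, hc₀, hc⟩⟩

end QuotCoalgebra

/-! ### The maps ⨁ Iⁿ ⟶ gr ⟶ ⨁ E/Iⁿ⁺¹ and uniqueness. -/

section GrMaps

variable {C : Type u} [Category.{v} C] [Abelian C] [MonoidalCategory C] [HasColimits C] {E : C}
  [MonObj E]

/-- The morphism `Iⁿ ⟶ gr_I E` of degree `n`. -/
noncomputable def toGr (I : Subobject E) (n : ℕ) : (powSub I n : C) ⟶ gr I :=
  grProj I n ≫ Sigma.ι (grDeg I) n

theorem powSumι_powToGr (I : Subobject E) (n : ℕ) : powSumι I n ≫ powToGr I = toGr I n := by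
  simp [powSumι, powToGr, toGr]

theorem ι_grToQuot (I : Subobject E) (n : ℕ) :
    Sigma.ι (grDeg I) n ≫ grToQuot I = grIncl I n ≫ quotSumι I n := by
  simp [grToQuot, quotSumι]

theorem toGr_grToQuot (I : Subobject E) (n : ℕ) :
    toGr I n ≫ grToQuot I = (powSub I n).arrow ≫ toQuotSum I n := by
  rw [toGr, Category.assoc, ι_grToQuot, reassoc_of% grProj_grIncl, toQuotSum]

instance epi_powToGr (I : Subobject E) : Epi (powToGr I) :=
  inferInstanceAs (Epi (Limits.Sigma.map (grProj I)))

/-- The splitting hypothesis provides a retraction in each degree, and their direct sum retracts the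
whole map. -/
theorem mono_grToQuot (I : Subobject E) [h : ∀ n, IsSplitEpi (quotMap I n)] :
    Mono (grToQuot I) := by
  have (n : ℕ) := isSplitMono_grIncl I n
  have : grToQuot I ≫ Limits.Sigma.map (fun n => retraction (grIncl I n)) = 𝟙 _ := by
    refine Sigma.hom_ext _ _ fun n => ?_
    simp [grToQuot]
  exact (SplitMono.mk _ this).mono

theorem gr_ext {I : Subobject E} {Z : C} {f g : gr I ⟶ Z}
    (h : ∀ n, toGr I n ≫ f = toGr I n ≫ g) : f = g := by
  refine Sigma.hom_ext _ _ fun n => ?_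
  rw [← cancel_epi (grProj I n)]
  simpa [toGr] using h n

theorem powSub_arrow_toQuotSum (I : Subobject E) {k n : ℕ} (h : n < k) :
    (powSub I k).arrow ≫ toQuotSum I n = 0 := by
  rw [toQuotSum, ← Category.assoc, powSub_arrow_quotProj I h, zero_comp]

theorem gr_tensor_ext [∀ X : C, PreservesFiniteColimits (tensorLeft X)]
    [∀ X : C, PreservesFiniteColimits (tensorRight X)]
    [∀ (X : C) (J : Type v), PreservesColimitsOfShape (Discrete J) (tensorLeft X)]
    [∀ (X : C) (J : Type v), PreservesColimitsOfShape (Discrete J) (tensorRight X)]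
    {I : Subobject E} {Z : C} {f g : gr I ⊗ gr I ⟶ Z}
    (h : ∀ a b, (toGr I a ⊗ₘ toGr I b) ≫ f = (toGr I a ⊗ₘ toGr I b) ≫ g) : f = g := by
  refine tensor_coprod_ext fun a b => ?_
  rw [← cancel_epi (grProj I a ⊗ₘ grProj I b), tensorHom_comp_tensorHom_assoc,
    tensorHom_comp_tensorHom_assoc]
  exact h a b

theorem isGrAlgebra_unique [∀ X : C, PreservesFiniteColimits (tensorLeft X)]
    [∀ X : C, PreservesFiniteColimits (tensorRight X)] {I : Subobject E} {A : MonObj (powSum I)} {M M' : MonObj (gr I)}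
    (h : IsGrAlgebra I A M) (h' : IsGrAlgebra I A M') : M = M' := by
  refine monObj_ext (h.one_hom.symm.trans h'.one_hom) ?_
  rw [← cancel_epi (powToGr I ⊗ₘ powToGr I)]
  exact h.mul_hom.symm.trans h'.mul_hom

theorem IsGrAlgebra.toGr_mul {I : Subobject E} {A : MonObj (powSum I)} (hA : IsPowAlgebra I A)
    {M : MonObj (gr I)} (hM : IsGrAlgebra I A M) {a b : ℕ}
    (f : (powSub I a : C) ⊗ (powSub I b : C) ⟶ (powSub I (a + b) : C))
    (hf : f ≫ (powSub I (a + b)).arrow = ((powSub I a).arrow ⊗ₘ (powSub I b).arrow) ≫ μ[E]) :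
    (toGr I a ⊗ₘ toGr I b) ≫ M.mul = f ≫ toGr I (a + b) := by
  obtain ⟨f', hf₁, hf₂⟩ := hA.mul a b
  obtain rfl := (cancel_mono (powSub I (a + b)).arrow).1 (hf.trans hf₁.symm)
  rw [← powSumι_powToGr, ← powSumι_powToGr, ← tensorHom_comp_tensorHom, Category.assoc]
  refine (congrArg _ hM.mul_hom.symm).trans ?_
  rw [reassoc_of% hf₂, powSumι_powToGr]

theorem IsGrAlgebra.one_grToQuot {I : Subobject E} {A : MonObj (powSum I)} (hA : IsPowAlgebra I A)
    {M : MonObj (gr I)} (hM : IsGrAlgebra I A M) :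
    M.one ≫ grToQuot I = η[E] ≫ toQuotSum I 0 := by
  obtain ⟨e, he, h⟩ := hA.one
  refine (congrArg (· ≫ _) hM.one_hom.symm).trans ?_
  rw [h, Category.assoc, Category.assoc, reassoc_of% powSumι_powToGr, toGr_grToQuot, reassoc_of% he]

theorem isGrCoalgebra_unique [∀ X : C, PreservesFiniteLimits (tensorLeft X)]
    [∀ X : C, PreservesFiniteLimits (tensorRight X)] {I : Subobject E} [Mono (grToQuot I)] {Q : ComonObj (quotSum I)}
    {D D' : ComonObj (gr I)} (h : IsGrCoalgebra I Q D) (h' : IsGrCoalgebra I Q D') : D = D' := by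
  refine comonObj_ext (h.hom_counit.symm.trans h'.hom_counit) ?_
  rw [← cancel_mono (grToQuot I ⊗ₘ grToQuot I)]
  exact h.hom_comul.symm.trans h'.hom_comul

theorem IsGrCoalgebra.toGr_comul [MonoidalPreadditive C] [ComonObj E] {I : Subobject E} {Q : ComonObj (quotSum I)}
    (hQ : IsQuotCoalgebra I Q) {D : ComonObj (gr I)} (hD : IsGrCoalgebra I Q D) (n : ℕ) :
    toGr I n ≫ D.comul ≫ (grToQuot I ⊗ₘ grToQuot I) =
      (powSub I n).arrow ≫ toQuotSumTensor I n := by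
  refine (congrArg _ hD.hom_comul.symm).trans ?_
  rw [reassoc_of% toGr_grToQuot, ((isQuotCoalgebra_iff I Q).1 hQ).1]

theorem IsGrCoalgebra.toGr_counit {I : Subobject E} {Q : ComonObj (quotSum I)}
    {D : ComonObj (gr I)} (hD : IsGrCoalgebra I Q D) (n : ℕ) :
    toGr I n ≫ D.counit = (powSub I n).arrow ≫ toQuotSum I n ≫ Q.counit := by
  refine (congrArg _ hD.hom_counit.symm).trans ?_
  rw [reassoc_of% toGr_grToQuot]

end GrMaps

/-! ### The graded algebra structure on gr. -/

section GrAlgebra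

variable {C : Type u} [Category.{v} C] [Abelian C] [MonoidalCategory C] [MonoidalPreadditive C]
  [∀ X : C, PreservesFiniteColimits (tensorLeft X)]
  [∀ X : C, PreservesFiniteColimits (tensorRight X)]
  {E : C} [MonObj E]

/-- The product of classes is well defined because Iᵃ⁺¹Iᵇ and IᵃIᵇ⁺¹ lie in Iᵃ⁺ᵇ⁺¹. -/
theorem exists_grDeg_mul (I : Subobject E) (hI : I.Factors (I.arrow ▷ E ≫ μ[E])) (a b : ℕ) :
    ∃ m : grDeg I a ⊗ grDeg I b ⟶ grDeg I (a + b),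
      (grProj I a ⊗ₘ grProj I b) ≫ m ≫ grIncl I (a + b) =
        ((powSub I a).arrow ⊗ₘ (powSub I b).arrow) ≫ μ[E] ≫ quotProj I (a + b + 1) := by
  obtain ⟨f, hf⟩ := exists_powSub_mul I hI a b
  have hf' : f ≫ grProj I (a + b) ≫ grIncl I (a + b) =
      ((powSub I a).arrow ⊗ₘ (powSub I b).arrow) ≫ μ[E] ≫ quotProj I (a + b + 1) := by
    rw [grProj_grIncl, reassoc_of% hf]
  let S (n : ℕ) : ShortComplex C := ShortComplex.mk (powIncl I n) (grProj I n) (cokernel.condition _)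
  have hS (n : ℕ) : (S n).Exact := ShortComplex.exact_cokernel _
  have (n : ℕ) : Epi (S n).g := inferInstanceAs (Epi (grProj I n))
  obtain ⟨m, hm⟩ := exists_tensor_desc (S a) (S b) (hS a) (hS b) (f ≫ grProj I (a + b))
    (by
      change powIncl I a ▷ _ ≫ f ≫ grProj I (a + b) = 0
      rw [← cancel_mono (grIncl I (a + b)), Category.assoc, Category.assoc, hf',
        whiskerRight_comp_tensorHom_assoc, powIncl_arrow, powSub_mul_quotProj I hI (by omega),
        zero_comp])
    (by
      change _ ◁ powIncl I b ≫ f ≫ grProj I (a + b) = 0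
      rw [← cancel_mono (grIncl I (a + b)), Category.assoc, Category.assoc, hf',
        whiskerLeft_comp_tensorHom_assoc, powIncl_arrow, powSub_mul_quotProj I hI (by omega),
        zero_comp])
  refine ⟨m, ?_⟩
  rw [← hf', ← Category.assoc, ← Category.assoc]
  exact congrArg (· ≫ _) hm

variable [HasColimits C]
  [∀ (X : C) (J : Type v), PreservesColimitsOfShape (Discrete J) (tensorLeft X)]
  [∀ (X : C) (J : Type v), PreservesColimitsOfShape (Discrete J) (tensorRight X)]

theorem exists_isGrAlgebra {I : Subobject E} (hI : I.Factors (I.arrow ▷ E ≫ μ[E]))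
    {A : MonObj (powSum I)} (hA : IsPowAlgebra I A) :
    ∃ M : MonObj (gr I), IsGrAlgebra I A M ∧ IsGradedAlgebra (grDeg I) M := by
  choose m hm using exists_grDeg_mul I hI
  let M : gr I ⊗ gr I ⟶ gr I := tensorDesc fun a b => m a b ≫ Sigma.ι (grDeg I) (a + b)
  have hM : ∀ a b, (Sigma.ι (grDeg I) a ⊗ₘ Sigma.ι (grDeg I) b) ≫ M =
      m a b ≫ Sigma.ι (grDeg I) (a + b) := fun a b => ι_tensorDesc _ a b
  have hp : (powToGr I ⊗ₘ powToGr I) ≫ M = A.mul ≫ powToGr I := by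
    refine tensor_coprod_ext fun a b => ?_
    obtain ⟨f, hf, hf'⟩ := hA.mul a b
    change (powSumι I a ⊗ₘ powSumι I b) ≫ _ = (powSumι I a ⊗ₘ powSumι I b) ≫ _
    have h : (grProj I a ⊗ₘ grProj I b) ≫ m a b = f ≫ grProj I (a + b) := by
      rw [← cancel_mono (grIncl I (a + b)), Category.assoc, hm, Category.assoc, grProj_grIncl,
        reassoc_of% hf]
    rw [tensorHom_comp_tensorHom_assoc, powSumι_powToGr, powSumι_powToGr, toGr, toGr,
      ← tensorHom_comp_tensorHom_assoc, hM, reassoc_of% h, reassoc_of% hf', powSumι_powToGr, toGr]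
  let G : MonObj (gr I) := monObjOfEpi (powToGr I) A M hp
  refine ⟨G, @IsMonHom.mk _ _ _ _ _ A G _ rfl hp.symm, fun n => ?_⟩
  have h : ∀ p : Finset.HasAntidiagonal.antidiagonal n,
      ∃ f : grDeg I p.1.1 ⊗ grDeg I p.1.2 ⟶ grDeg I n,
        (Sigma.ι (grDeg I) p.1.1 ⊗ₘ Sigma.ι (grDeg I) p.1.2) ≫ M = f ≫ Sigma.ι (grDeg I) n := by
    rintro ⟨⟨a, b⟩, hab⟩
    obtain rfl := Finset.HasAntidiagonal.mem_antidiagonal.1 hab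
    exact ⟨m a b, hM a b⟩
  choose f hf using h
  refine ⟨Sigma.desc f, Sigma.hom_ext _ _ fun p => ?_⟩
  rw [tensorDegIncl, Sigma.ι_desc_assoc, Sigma.ι_desc_assoc]
  exact hf p

end GrAlgebra

/-! ### The graded coalgebra structure on gr. -/

section GrCoalgebra

variable {C : Type u} [Category.{v} C] [Abelian C] [MonoidalCategory C] [MonoidalPreadditive C]
  [∀ X : C, PreservesFiniteLimits (tensorLeft X)]
  [∀ X : C, PreservesFiniteLimits (tensorRight X)]
  {E : C} [MonObj E] [ComonObj E]

/-- Δ on Iⁿ, read in E/Iᵃ⁺¹ ⊗ E/Iᵇ⁺¹, kills Iⁿ⁺¹. It also dies in E/Iᵃ ⊗ E/Iᵇ⁺¹ and E/Iᵃ⁺¹ ⊗ E/Iᵇ,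
as a + b + 1 = n + 1, so left exactness places it in the tensor product of the kernels Iᵃ/Iᵃ⁺¹ and
Iᵇ/Iᵇ⁺¹. -/
theorem exists_grDeg_comul (I : Subobject E)
    (h : ∀ a b n, a + b ≤ n + 1 →
      (powSub I n).arrow ≫ Δ[E] ≫ (quotProj I a ⊗ₘ quotProj I b) = 0)
    {a b n : ℕ} (hn : a + b = n) :
    ∃ d : grDeg I n ⟶ grDeg I a ⊗ grDeg I b, grProj I n ≫ d ≫ (grIncl I a ⊗ₘ grIncl I b) =
      (powSub I n).arrow ≫ Δ[E] ≫ (quotProj I (a + 1) ⊗ₘ quotProj I (b + 1)) := by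
  let f : grDeg I n ⟶ quot I (a + 1) ⊗ quot I (b + 1) :=
    cokernel.desc (powIncl I n)
      ((powSub I n).arrow ≫ Δ[E] ≫ (quotProj I (a + 1) ⊗ₘ quotProj I (b + 1)))
      (by rw [← Category.assoc, powIncl_arrow, h _ _ _ (by omega)])
  have hf : grProj I n ≫ f =
      (powSub I n).arrow ≫ Δ[E] ≫ (quotProj I (a + 1) ⊗ₘ quotProj I (b + 1)) :=
    cokernel.π_desc _ _ _
  have (n : ℕ) : Mono (grSequence I n).f := inferInstanceAs (Mono (grIncl I n))
  obtain ⟨d, hd⟩ := exists_tensor_lift (grSequence I a) (grSequence I b) (grSequence_exact I a)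
    (grSequence_exact I b) f
    (by
      change f ≫ quotMap I a ▷ _ = 0
      rw [← cancel_epi (grProj I n), reassoc_of% hf, tensorHom_comp_whiskerRight, quotProj_quotMap,
        h _ _ _ (by omega), comp_zero])
    (by
      change f ≫ _ ◁ quotMap I b = 0
      rw [← cancel_epi (grProj I n), reassoc_of% hf, tensorHom_comp_whiskerLeft, quotProj_quotMap,
        h _ _ _ (by omega), comp_zero])
  exact ⟨d, (congrArg _ hd).trans hf⟩

variable [HasColimits C]

theorem exists_isGrCoalgebra {I : Subobject E} [Mono (grToQuot I)]
    (h : ∀ a b n, a + b ≤ n + 1 →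
      (powSub I n).arrow ≫ Δ[E] ≫ (quotProj I a ⊗ₘ quotProj I b) = 0)
    {Q : ComonObj (quotSum I)} (hQ : IsQuotCoalgebra I Q) :
    ∃ D : ComonObj (gr I), IsGrCoalgebra I Q D ∧ IsGradedCoalgebra (grDeg I) D := by
  choose δ hδ using fun (n : ℕ) (p : Finset.HasAntidiagonal.antidiagonal n) =>
    exists_grDeg_comul I h (Finset.HasAntidiagonal.mem_antidiagonal.1 p.2)
  let d (n : ℕ) : grDeg I n ⟶ tensorDeg (grDeg I) n :=
    ∑ p, δ n p ≫ Sigma.ι (fun p : Finset.HasAntidiagonal.antidiagonal n =>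
      grDeg I p.1.1 ⊗ grDeg I p.1.2) p
  let D : gr I ⟶ gr I ⊗ gr I := Sigma.desc fun n => d n ≫ tensorDegIncl (grDeg I) n
  have hD (n : ℕ) : Sigma.ι (grDeg I) n ≫ D = d n ≫ tensorDegIncl (grDeg I) n := Sigma.ι_desc _ _
  have hw : D ≫ (grToQuot I ⊗ₘ grToQuot I) = grToQuot I ≫ Q.comul := by
    refine gr_ext fun n => ?_
    rw [reassoc_of% toGr_grToQuot, ((isQuotCoalgebra_iff I Q).1 hQ).1, toGr, Category.assoc,
      reassoc_of% hD, toQuotSumTensor]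
    simp only [d, Preadditive.sum_comp, Preadditive.comp_sum]
    rw [← Finset.sum_coe_sort (Finset.HasAntidiagonal.antidiagonal n)]
    refine Finset.sum_congr rfl fun p _ => ?_
    rw [tensorDegIncl, Category.assoc, Sigma.ι_desc_assoc, tensorHom_comp_tensorHom, ι_grToQuot,
      ι_grToQuot, ← tensorHom_comp_tensorHom, reassoc_of% hδ, toQuotSum, toQuotSum,
      tensorHom_comp_tensorHom]
  let G : ComonObj (gr I) := comonObjOfMono (grToQuot I) Q D hw
  exact ⟨G, @IsComonHom.mk _ _ _ _ _ G Q _ rfl hw.symm, fun n => ⟨d n, hD n⟩⟩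

end GrCoalgebra

/-! ### Compatibility of the two structures on gr. -/

section Bialgebra

variable {C : Type u} [Category.{v} C] [Abelian C] [MonoidalCategory C] [HasColimits C] {E : C}

/-- The morphism `⨁_{a+b=n} Iᵃ ⊗ Iᵇ ⟶ gr_I E ⊗ gr_I E` induced by the projections. -/
noncomputable def powTensorToGr [MonObj E] (I : Subobject E) (n : ℕ) :
    tensorDeg (fun n => (powSub I n : C)) n ⟶ gr I ⊗ gr I :=
  Sigma.desc fun p => toGr I p.1.1 ⊗ₘ toGr I p.1.2

theorem ι_powTensorToGr [MonObj E] (I : Subobject E) (n : ℕ)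
    (p : Finset.HasAntidiagonal.antidiagonal n) :
    Sigma.ι (fun p : Finset.HasAntidiagonal.antidiagonal n =>
      (powSub I p.1.1 : C) ⊗ (powSub I p.1.2 : C)) p ≫ powTensorToGr I n =
      toGr I p.1.1 ⊗ₘ toGr I p.1.2 :=
  Sigma.ι_desc _ _

/-- The degree `n` part of the projection of `E ⊗ E` onto the tensor square of `⨁ₙ E / Iⁿ⁺¹`. -/
noncomputable def quotTensor [MonObj E] (I : Subobject E) (n : ℕ) :
    E ⊗ E ⟶ quotSum I ⊗ quotSum I :=
  ∑ p ∈ Finset.HasAntidiagonal.antidiagonal n, (toQuotSum I p.1 ⊗ₘ toQuotSum I p.2)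

theorem toQuotSumTensor_eq [MonObj E] [ComonObj E] (I : Subobject E) (n : ℕ) :
    toQuotSumTensor I n = Δ[E] ≫ quotTensor I n := by
  rw [toQuotSumTensor, quotTensor, Preadditive.comp_sum]

variable [MonoidalPreadditive C]

/-- If k + l = a + b and (k, l) ≠ (a, b), then k < a or l < b, and Iᵃ ⊗ Iᵇ dies in E/Iᵏ⁺¹ ⊗ E/Iˡ⁺¹.
Only the term (a, b) remains. -/
theorem powSub_tensor_quotTensor [MonObj E] (I : Subobject E) {a b n : ℕ} (h : a + b = n) :
    ((powSub I a).arrow ⊗ₘ (powSub I b).arrow) ≫ quotTensor I n =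
      (toGr I a ⊗ₘ toGr I b) ≫ (grToQuot I ⊗ₘ grToQuot I) := by
  rw [quotTensor, Preadditive.comp_sum, Finset.sum_eq_single (a, b), tensorHom_comp_tensorHom,
    tensorHom_comp_tensorHom, toGr_grToQuot, toGr_grToQuot]
  · rintro ⟨k, l⟩ hkl hne
    have hkl' := Finset.HasAntidiagonal.mem_antidiagonal.1 hkl
    dsimp only at hkl' ⊢
    rw [tensorHom_comp_tensorHom]
    rcases lt_trichotomy k a with hk | hk | hk
    · rw [powSub_arrow_toQuotSum I hk, MonoidalPreadditive.zero_tensor]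
    · exact absurd (Prod.ext hk (show l = b by omega)) hne
    · rw [powSub_arrow_toQuotSum I (show l < b by omega), MonoidalPreadditive.tensor_zero]
  · intro h'
    exact absurd (Finset.HasAntidiagonal.mem_antidiagonal.2 h) h'

theorem powTensor_quotTensor [MonObj E] (I : Subobject E) (n : ℕ) :
    powTensor I n ≫ quotTensor I n = powTensorToGr I n ≫ (grToQuot I ⊗ₘ grToQuot I) := by
  refine Sigma.hom_ext _ _ fun p => ?_
  rw [reassoc_of% ι_powTensor, reassoc_of% ι_powTensorToGr,
    powSub_tensor_quotTensor I (Finset.HasAntidiagonal.mem_antidiagonal.1 p.2)]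

theorem gr_one_comul [BraidedCategory C] [∀ X : C, PreservesFiniteLimits (tensorLeft X)]
    [∀ X : C, PreservesFiniteLimits (tensorRight X)] [BimonObj E] {I : Subobject E} [Mono (grToQuot I)]
    {A : MonObj (powSum I)} (hA : IsPowAlgebra I A)
    {Q : ComonObj (quotSum I)} (hQ : IsQuotCoalgebra I Q)
    {M : MonObj (gr I)} (hM : IsGrAlgebra I A M) {D : ComonObj (gr I)}
    (hD : IsGrCoalgebra I Q D) :
    M.one ≫ D.comul = (λ_ (𝟙_ C)).inv ≫ (M.one ⊗ₘ M.one) := by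
  rw [← cancel_mono (grToQuot I ⊗ₘ grToQuot I), Category.assoc, Category.assoc,
    tensorHom_comp_tensorHom, hM.one_grToQuot hA]
  refine (congrArg _ hD.hom_comul.symm).trans ?_
  rw [reassoc_of% hM.one_grToQuot hA, ((isQuotCoalgebra_iff I Q).1 hQ).1, toQuotSumTensor]
  simp [MonObj.tensorObj.one_def]

theorem gr_one_counit [BraidedCategory C] [BimonObj E] {I : Subobject E}
    {A : MonObj (powSum I)} (hA : IsPowAlgebra I A)
    {Q : ComonObj (quotSum I)} (hQ : IsQuotCoalgebra I Q)
    {M : MonObj (gr I)} (hM : IsGrAlgebra I A M) {D : ComonObj (gr I)}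
    (hD : IsGrCoalgebra I Q D) : M.one ≫ D.counit = 𝟙 (𝟙_ C) := by
  refine (congrArg _ hD.hom_counit.symm).trans ?_
  rw [reassoc_of% hM.one_grToQuot hA, ((isQuotCoalgebra_iff I Q).1 hQ).2.1, BimonObj.one_counit]

variable [BraidedCategory C]
  [∀ X : C, PreservesFiniteColimits (tensorLeft X)]
  [∀ X : C, PreservesFiniteColimits (tensorRight X)]
  [∀ (X : C) (J : Type v), PreservesColimitsOfShape (Discrete J) (tensorLeft X)]
  [∀ (X : C) (J : Type v), PreservesColimitsOfShape (Discrete J) (tensorRight X)]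

/-- Both sides vanish on Iᵃ ⊗ Iᵇ unless a = b = 0, where the identity is the multiplicativity of ε.
-/
theorem gr_mul_counit [BimonObj E] {I : Subobject E}
    (hI : IsRightBiideal I) {A : MonObj (powSum I)} (hA : IsPowAlgebra I A)
    {Q : ComonObj (quotSum I)} (hQ : IsQuotCoalgebra I Q)
    {M : MonObj (gr I)} (hM : IsGrAlgebra I A M) {D : ComonObj (gr I)}
    (hD : IsGrCoalgebra I Q D) :
    M.mul ≫ D.counit = (D.counit ⊗ₘ D.counit) ≫ (λ_ (𝟙_ C)).hom := by
  obtain ⟨-, h₀, h⟩ := (isQuotCoalgebra_iff I Q).1 hQ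
  refine gr_tensor_ext fun a b => ?_
  obtain ⟨f, hf⟩ := exists_powSub_mul I hI.mul a b
  rw [reassoc_of% hM.toGr_mul hA f hf, hD.toGr_counit, tensorHom_comp_tensorHom_assoc,
    hD.toGr_counit, hD.toGr_counit, reassoc_of% hf]
  cases b with
  | succ b => rw [h b, ← add_assoc, h (a + b)]; simp
  | zero =>
    cases a with
    | succ a => change _ ≫ _ ≫ toQuotSum I (a + 1) ≫ _ = _; rw [h a]; simp
    | zero =>
      rw [h₀, BimonObj.mul_counit, Comon.tensorObj_counit, tensorHom_comp_tensorHom_assoc]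

variable [∀ X : C, PreservesFiniteLimits (tensorLeft X)]
  [∀ X : C, PreservesFiniteLimits (tensorRight X)]

/-- Locally, the comultiplication of `E` on `Iⁿ` takes values in `⨁_{a+b=n} Iᵃ ⊗ Iᵇ`, and this
also computes the comultiplication of `gr_I E`. -/
theorem exists_cover_comul [BimonObj E] {I : Subobject E} [Mono (grToQuot I)]
    (hI : IsRightBiideal I) {Q : ComonObj (quotSum I)} (hQ : IsQuotCoalgebra I Q)
    {D : ComonObj (gr I)} (hD : IsGrCoalgebra I Q D) (n : ℕ) :
    ∃ (P : C) (e : P ⟶ (powSub I n : C)) (_ : Epi e)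
      (t : P ⟶ tensorDeg (fun n => (powSub I n : C)) n),
      e ≫ (powSub I n).arrow ≫ Δ[E] = t ≫ powTensor I n ∧
      e ≫ toGr I n ≫ D.comul = t ≫ powTensorToGr I n := by
  obtain ⟨P, e, he, t, ht⟩ := exists_cover ((powSub I n).arrow ≫ Δ[E])
    (by rw [Category.assoc, powSub_comul_cokernel hI])
  refine ⟨P, e, he, t, ht, ?_⟩
  rw [← cancel_mono (grToQuot I ⊗ₘ grToQuot I), Category.assoc, Category.assoc, Category.assoc,
    hD.toGr_comul hQ, ← powTensor_quotTensor, toQuotSumTensor_eq, ← reassoc_of% ht]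

theorem gr_mul_comul [BimonObj E] {I : Subobject E} [Mono (grToQuot I)]
    (hI : IsRightBiideal I) {A : MonObj (powSum I)} (hA : IsPowAlgebra I A)
    {Q : ComonObj (quotSum I)} (hQ : IsQuotCoalgebra I Q)
    {M : MonObj (gr I)} (hM : IsGrAlgebra I A M) {D : ComonObj (gr I)}
    (hD : IsGrCoalgebra I Q D) :
    M.mul ≫ D.comul = (D.comul ⊗ₘ D.comul) ≫ tensorμ _ _ _ _ ≫ (M.mul ⊗ₘ M.mul) := by
  rw [← cancel_mono (grToQuot I ⊗ₘ grToQuot I)]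
  refine gr_tensor_ext fun a b => ?_
  obtain ⟨f, hf⟩ := exists_powSub_mul I hI.mul a b
  obtain ⟨P, e, _, t, ht, ht'⟩ := exists_cover_comul hI hQ hD a
  obtain ⟨P', e', _, t', ht₁, ht₁'⟩ := exists_cover_comul hI hQ hD b
  -- Multiplying in E ⊗ E and then projecting agrees with projecting to gr ⊗ gr and then
  -- multiplying: on each summand both give the class in degrees (i + k, j + l).
  have key : (powTensor I a ⊗ₘ powTensor I b) ≫ tensorμ E E E E ≫ (μ[E] ⊗ₘ μ[E]) ≫
      quotTensor I (a + b) = (powTensorToGr I a ⊗ₘ powTensorToGr I b) ≫ tensorμ _ _ _ _ ≫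
        (M.mul ⊗ₘ M.mul) ≫ (grToQuot I ⊗ₘ grToQuot I) := by
    refine tensor_coprod_ext fun p q => ?_
    obtain ⟨m, hm⟩ := exists_powSub_mul I hI.mul p.1.1 q.1.1
    obtain ⟨m', hm'⟩ := exists_powSub_mul I hI.mul p.1.2 q.1.2
    have hp := Finset.HasAntidiagonal.mem_antidiagonal.1 p.2
    have hq := Finset.HasAntidiagonal.mem_antidiagonal.1 q.2
    trans tensorμ _ _ _ _ ≫ (m ⊗ₘ m') ≫
      (toGr I (p.1.1 + q.1.1) ⊗ₘ toGr I (p.1.2 + q.1.2)) ≫ (grToQuot I ⊗ₘ grToQuot I)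
    · rw [tensorHom_comp_tensorHom_assoc, ι_powTensor, ι_powTensor, tensorμ_natural_assoc,
        tensorHom_comp_tensorHom_assoc, ← hm, ← hm', ← tensorHom_comp_tensorHom_assoc,
        powSub_tensor_quotTensor I (by omega)]
    · rw [tensorHom_comp_tensorHom_assoc (Sigma.ι _ p), ι_powTensorToGr, ι_powTensorToGr,
        tensorμ_natural_assoc, tensorHom_comp_tensorHom_assoc (toGr I _ ⊗ₘ toGr I _),
        hM.toGr_mul hA m hm, hM.toGr_mul hA m' hm', tensorHom_comp_tensorHom_assoc m]
  rw [Category.assoc, reassoc_of% hM.toGr_mul hA f hf, hD.toGr_comul hQ, reassoc_of% hf,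
    toQuotSumTensor_eq, BimonObj.mul_comul_assoc, tensorHom_comp_tensorHom_assoc, Category.assoc,
    Category.assoc, tensorHom_comp_tensorHom_assoc, ← cancel_epi (e ⊗ₘ e'),
    tensorHom_comp_tensorHom_assoc, tensorHom_comp_tensorHom_assoc, ht, ht', ht₁, ht₁',
    ← tensorHom_comp_tensorHom_assoc, key, ← tensorHom_comp_tensorHom_assoc]

/-- The bialgebra structure on `gr_I E` with given algebra and coalgebra structures. -/
abbrev grBimonObj [BimonObj E] {I : Subobject E} [Mono (grToQuot I)]
    (hI : IsRightBiideal I) {A : MonObj (powSum I)} (hA : IsPowAlgebra I A)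
    {Q : ComonObj (quotSum I)} (hQ : IsQuotCoalgebra I Q)
    {M : MonObj (gr I)} (hM : IsGrAlgebra I A M) {D : ComonObj (gr I)}
    (hD : IsGrCoalgebra I Q D) : BimonObj (gr I) :=
  { M, D with
    mul_comul := gr_mul_comul hI hA hQ hM hD
    one_comul := gr_one_comul hA hQ hM hD
    mul_counit := gr_mul_counit hI hA hQ hM hD
    one_counit := gr_one_counit hA hQ hM hD }

end Bialgebra

end GradedBialgebra

/-- The two final equivalences express existence and uniqueness at once, and force the bialgebra to
carry exactly those structures. -/
theorem mainTheorem4 {C : Type u} [Category.{v} C] [Abelian C]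
    [HasColimits C] [HasLimits C] [AB5 C]
    [MonoidalCategory C] [BraidedCategory C] [MonoidalPreadditive C]
    [∀ X : C, PreservesFiniteColimits (tensorLeft X)]
    [∀ X : C, PreservesFiniteColimits (tensorRight X)]
    [∀ X : C, PreservesFiniteLimits (tensorLeft X)]
    [∀ X : C, PreservesFiniteLimits (tensorRight X)]
    [∀ (X : C) (J : Type v), PreservesColimitsOfShape (Discrete J) (tensorLeft X)]
    [∀ (X : C) (J : Type v), PreservesColimitsOfShape (Discrete J) (tensorRight X)]
    {E B : C} [BimonObj E] [BimonObj B] (π : E ⟶ B) [Epi π] [IsBimonHom π]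
    (I : Subobject E) (hI : I = kernelSubobject π)
    (hsplit : ∀ a : ℕ, IsSplitEpi (GradedBialgebra.quotMap I a)) :
    (∃! A : MonObj (GradedBialgebra.powSum I), GradedBialgebra.IsPowAlgebra I A) ∧
    (∃! Q : ComonObj (GradedBialgebra.quotSum I), GradedBialgebra.IsQuotCoalgebra I Q) ∧
    ∀ (A : MonObj (GradedBialgebra.powSum I)) (Q : ComonObj (GradedBialgebra.quotSum I)),
      GradedBialgebra.IsPowAlgebra I A → GradedBialgebra.IsQuotCoalgebra I Q →
      ∃ G : BimonObj (GradedBialgebra.gr I),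
        GradedBialgebra.IsGradedBialgebra (GradedBialgebra.grDeg I) G ∧
        (∀ M : MonObj (GradedBialgebra.gr I),
          GradedBialgebra.IsGrAlgebra I A M ↔ M = G.toMonObj) ∧
        (∀ D : ComonObj (GradedBialgebra.gr I),
          GradedBialgebra.IsGrCoalgebra I Q D ↔ D = G.toComonObj) := by
  subst hI
  have hI := GradedBialgebra.kernelSubobject_isRightBiideal (E := E) π
  have := GradedBialgebra.mono_grToQuot (kernelSubobject π)
  have hΔ : ∀ a b n, a + b ≤ n + 1 →
      (GradedBialgebra.powSub (kernelSubobject π) n).arrow ≫ Δ[E] ≫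
        (GradedBialgebra.quotProj (kernelSubobject π) a ⊗ₘ
          GradedBialgebra.quotProj (kernelSubobject π) b) = 0 :=
    fun a b n h => GradedBialgebra.powSub_comul_quotProj hI h
  refine ⟨?_, ?_, fun A Q hA hQ => ?_⟩
  · obtain ⟨A, hA⟩ := GradedBialgebra.exists_isPowAlgebra _ hI.mul
    exact ⟨A, hA, fun A' hA' => GradedBialgebra.isPowAlgebra_unique _ hA' hA⟩
  · obtain ⟨Q, hQ⟩ := GradedBialgebra.exists_isQuotCoalgebra _ hΔ
      (GradedBialgebra.powSub_one_counit hI)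
    exact ⟨Q, hQ, fun Q' hQ' => GradedBialgebra.isQuotCoalgebra_unique _ hQ' hQ⟩
  · obtain ⟨M, hM, hM'⟩ := GradedBialgebra.exists_isGrAlgebra hI.mul hA
    obtain ⟨D, hD, hD'⟩ := GradedBialgebra.exists_isGrCoalgebra hΔ hQ
    refine ⟨GradedBialgebra.grBimonObj hI hA hQ hM hD, ⟨hM', hD'⟩, fun M' => ?_, fun D' => ?_⟩
    · exact ⟨fun h => GradedBialgebra.isGrAlgebra_unique h hM, fun h => by subst h; exact hM⟩
    · exact ⟨fun h => GradedBialgebra.isGrCoalgebra_unique h hD, fun h => by subst h; exact hD⟩
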